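/- All logarithms are to base $2$. An ordering of a finite graph $G$ is a pair $\mathcal G=(G,\prec)$ with $\prec$ a total order on $V(G)$. The ordered Ramsey number $\overline{R}(\mathcal G)$ is the least integer $N$ such that every coloring of the edges of the complete graph on $\{1<2<\dots<N\}$ by two colors contains a monochromatic copy of $\mathcal G$, i.e. there is an order-preserving injection $V(G)\to\{1,\dots,N\}$ that maps all edges of $G$ to edges of one and the same color. Let $\operatorname{min-}\overline{R}(G)$ be the minimum of $\overline{R}(\mathcal G)$ over all orderings $\mathcal G$ of $G$. For a real $\rho>0$ and a positive integer $n$ with $\lceil\rho n\rceil$ even, a graph on $n$ vertices is called $\rho$-regular if each of its vertices has degree $\lfloor\rho\rfloor$ or $\lceil\rho\rceil$ and it has exactly $\lceil \rho n\rceil/2$ edges. Let $G(\rho,n)$ be a uniformly random $\rho$-regular graph on the vertex set $\{1,\dots,n\}$. For a sequence $\rho_n$, the graph $G(\rho_n,n)$ has a property asymptotically almost surely if the probability that it has it tends to $1$ as $n\to\infty$ through the integers $n$ with $\lceil\rho_n n\rceil$ even (in particular, $\rho_n$-regular graphs exist for all sufficiently large such $n$). (i) For every fixed real $\rho>2$,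 asymptotically almost surely \[\operatorname{min-}\overline{R}(G(\rho,n))\ \ge\ \frac{n^{3/2-1/\rho}}{4\log n\,\log\log n}.\] In particular, almost every $3$-regular graph $G$ on $n$ vertices ($n$ even) satisfies $\operatorname{min-}\overline{R}(G)\ge n^{7/6}/(4\log n\log\log n)$; hence almost every $3$-regular graph has superlinear ordered Ramsey number for all orderings: for every constant $C$, the proportion of the graphs $G$ with $\overline{R}(\mathcal G)\ge Cn$ for every ordering $\mathcal G$ of $G$ among all $3$-regular graphs on $\{1,\dots,n\}$ tends to $1$ as $n\to\infty$ through the even integers. (ii) Asymptotically almost surely \[\operatorname{min-}\overline{R}\left(G\left(2+\frac{9\log\log n}{\log n},\,n\right)\right)\ \ge\ \frac{n\log n}{2\log\log n}.\] -/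

import Mathlib

open Filter Topology ProbabilityTheory

/-- An ordered graph: a graph together with a total ordering of its vertices. -/
structure OrderedGraph (V : Type*) where
  graph : SimpleGraph V
  order : LinearOrder V

namespace OrderedGraph

/-- `𝒢` is isomorphic to an ordered subgraph of `ℋ`: some map of the vertices preserves the strict
orderings (hence is injective) and sends edges to edges. -/
def IsContained {V W : Type*} (𝒢 : OrderedGraph V) (ℋ : OrderedGraph W) : Prop :=
  ∃ f : V → W, (∀ u v, 𝒢.order.lt u v → ℋ.order.lt (f u) (f v)) ∧
    ∀ u v, 𝒢.graph.Adj u v → ℋ.graph.Adj (f u) (f v)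

/-- Every coloring of the edges of the ordered complete graph on `N` vertices by two colors
contains a monochromatic copy of `𝒢`. -/
def Arrows {V : Type*} (𝒢 : OrderedGraph V) (N : ℕ) : Prop :=
  ∀ c : SimpleGraph.TopEdgeLabeling (Fin N) Bool, ∃ b : Bool,
    𝒢.IsContained ⟨c.labelGraph b, inferInstance⟩

/-- The ordered Ramsey number: the least `N` such that every 2-coloring of the ordered complete
graph on `N` vertices contains a monochromatic copy of `𝒢`. -/
noncomputable def ramsey {V : Type*} (𝒢 : OrderedGraph V) : ℕ :=
  sInf {N : ℕ | 𝒢.Arrows N}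

end OrderedGraph

/-- The minimum of the ordered Ramsey numbers over all orderings of `G`. -/
noncomputable def minOrderedRamsey {V : Type*} (G : SimpleGraph V) : ℕ :=
  ⨅ o : LinearOrder V, OrderedGraph.ramsey ⟨G, o⟩

open Classical in
/-- `G` is `ρ`-regular for a real number `ρ`: all degrees are `⌊ρ⌋` or `⌈ρ⌉`, and the number of
edges is `⌈ρ n⌉ / 2` (so that `⌈ρ n⌉` is even). -/
def IsRealRegular {n : ℕ} (ρ : ℝ) (G : SimpleGraph (Fin n)) : Prop :=
  (∀ v, (G.degree v : ℤ) = ⌊ρ⌋ ∨ (G.degree v : ℤ) = ⌈ρ⌉) ∧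
    2 * (G.edgeFinset.card : ℤ) = ⌈ρ * n⌉

/-- The random graph `G(ρ n, n)`, uniform among the `ρ n`-regular graphs on `n` labeled vertices,
has the property `A` asymptotically almost surely. Here `n` tends to infinity through the integers
for which `⌈ρ n * n⌉` is even, the others admitting no `ρ n`-regular graph. As the probability
`uniformOn ∅` is zero, this includes that `ρ n`-regular graphs exist for all large such `n`. -/
def RealRegularAAS (ρ : ℕ → ℝ) (A : (n : ℕ) → SimpleGraph (Fin n) → Prop) : Prop :=
  Tendsto (fun n : ℕ => uniformOn {G : SimpleGraph (Fin n) | IsRealRegular (ρ n) G} {G | A n G})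
    (atTop ⊓ 𝓟 {n : ℕ | Even ⌈ρ n * n⌉}) (𝓝 1)

open Classical in
/-- Almost every `d`-regular graph on `n` labeled vertices has the property `A`, as `n` tends to
infinity through the integers for which `d * n` is even. -/
def AlmostEveryRegular (d : ℕ) (A : (n : ℕ) → SimpleGraph (Fin n) → Prop) : Prop :=
  Tendsto (fun n : ℕ => uniformOn {G : SimpleGraph (Fin n) | G.IsRegularOfDegree d} {G | A n G})
    (atTop ⊓ 𝓟 {n : ℕ | Even (d * n)}) (𝓝 1)

/-! Write `L = log n` and `K = log log n`. Cut the host vertices into `M`, about `n / (4LK)`,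
consecutive blocks of size `s`, about `n^(1/2 - 1/ρ)`. Colour the pairs of blocks at random,
including each block with itself, and let every edge inherit the colour of its pair. A monochromatic
copy of an ordering of `G` induces a monotone map from the vertices to the blocks with fibres of
size at most `s`. If the edges of `G` meet more than `X`, about `2n / L`, block pairs under every
map with such fibres (`IsSpread`), a union bound over the at most `(n + M).choose M` monotone maps
and the two colours leaves a colouring without a copy (`not_arrows_of_isSpread`). `IsSpread`
involves no order, so all orderings are handled at once.

Almost every `ρ`-regular graph is spread, by comparing two counts. An edge set that is not spread
lies in the preimage of `X` block pairs, which has at most `X s²` elements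
(`card_not_isSpread_mul_factorial_le`). The number of `ρ`-regular graphs is at least about `E! /
D^(2E)`, where `E` is the number of edges (`factorial_le_card_isRealRegular`); this comes from
adding edges one at a time, with exchanges for the last few. In the quotient, `E ≥ ρn/2` makes the
factor `n^(-2E/ρ)` from `s^(2E)` cancel the `n^n` choices of the map, and the factor `1/L` in `X`
beats every remaining exponential (`le_half_pow_mul_of_factorial_bounds`). -/

/-! ### Counting graphs with prescribed degrees -/

section DegreeBounded

open Finset

variable {V : Type*} [DecidableEq V]

/-- The number of edges of the edge set `H` that contain the vertex `v`. -/
def edgeDegree (H : Finset (Sym2 V)) (v : V) : ℕ := #{e ∈ H | v ∈ e}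

lemma edgeDegree_insert {H : Finset (Sym2 V)} {e : Sym2 V} (he : e ∉ H) (v : V) :
    edgeDegree (insert e H) v = edgeDegree H v + if v ∈ e then 1 else 0 := by
  unfold edgeDegree
  rw [filter_insert]
  split_ifs with h
  · rw [card_insert_of_notMem (by simp [he])]
  · rfl

lemma edgeDegree_erase {H : Finset (Sym2 V)} {e : Sym2 V} (he : e ∈ H) (v : V) :
    edgeDegree (H.erase e) v + (if v ∈ e then 1 else 0) = edgeDegree H v := by
  rw [← edgeDegree_insert (notMem_erase e H), insert_erase he]

lemma card_filter_exists_mem_le (H : Finset (Sym2 V)) (U : Finset V) {D : ℕ}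
    (hD : ∀ v, edgeDegree H v ≤ D) : #{e ∈ H | ∃ v ∈ U, v ∈ e} ≤ #U * D := by
  have : {e ∈ H | ∃ v ∈ U, v ∈ e} = U.biUnion fun v => {e ∈ H | v ∈ e} := by
    ext e
    simp only [mem_filter, mem_biUnion]
    tauto
  rw [this]
  exact card_biUnion_le_card_mul _ _ _ fun v _ => hD v

variable [Fintype V]

/-- The edge sets of the simple graphs with `i` edges whose degrees are bounded by `f`. -/
def degreeBoundedEdgeSets (f : V → ℕ) (i : ℕ) : Finset (Finset (Sym2 V)) :=
  {H | (∀ e ∈ H, ¬ e.IsDiag) ∧ (∀ v, edgeDegree H v ≤ f v) ∧ #H = i}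

lemma mem_degreeBoundedEdgeSets {f : V → ℕ} {i : ℕ} {H : Finset (Sym2 V)} :
    H ∈ degreeBoundedEdgeSets f i ↔
      (∀ e ∈ H, ¬ e.IsDiag) ∧ (∀ v, edgeDegree H v ≤ f v) ∧ #H = i := by
  simp [degreeBoundedEdgeSets]

lemma sum_edgeDegree {H : Finset (Sym2 V)} (hH : ∀ e ∈ H, ¬ e.IsDiag) :
    ∑ v, edgeDegree H v = 2 * #H := by
  have h := sum_card_bipartiteAbove_eq_sum_card_bipartiteBelow (s := (univ : Finset V)) (t := H)
    (fun v e => v ∈ e)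
  simp only [bipartiteAbove, bipartiteBelow] at h
  unfold edgeDegree
  rw [h, sum_congr rfl (g := fun _ => 2), sum_const, smul_eq_mul, mul_comm]
  intro e he
  rw [← Sym2.card_toFinset_of_not_isDiag e (hH e he)]
  congr 1
  ext v
  simp

/-- The vertices whose degree is smaller than the prescribed bound. -/
def deficient (f : V → ℕ) (H : Finset (Sym2 V)) : Finset V := {v | edgeDegree H v < f v}

lemma two_mul_sub_eq_sum_deficient {f : V → ℕ} {E i : ℕ} (hf : ∑ v, f v = 2 * E)
    {H : Finset (Sym2 V)} (hH : H ∈ degreeBoundedEdgeSets f i) :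
    2 * (E - i) = ∑ v ∈ deficient f H, (f v - edgeDegree H v) := by
  obtain ⟨h1, h2, h3⟩ := mem_degreeBoundedEdgeSets.1 hH
  have hs := sum_edgeDegree h1
  have : ∑ v ∈ deficient f H, (f v - edgeDegree H v) = ∑ v, (f v - edgeDegree H v) := by
    refine sum_subset (subset_univ _) fun v _ hv => ?_
    simp only [deficient, mem_filter, mem_univ, true_and, not_lt] at hv
    omega
  rw [this, sum_tsub_distrib _ fun v _ => h2 v, hf, hs, h3]
  omega

/-- Counting the edges that can be added to an edge set with degrees bounded by `f`. -/
lemma card_mul_sq_le_card_succ {f : V → ℕ} {D E i : ℕ} (hfD : ∀ v, f v ≤ D)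
    (hf : ∑ v, f v = 2 * E) (hi : D * (2 * D + 1) ≤ E - i) :
    #(degreeBoundedEdgeSets f i) * (E - i) ^ 2 ≤
      #(degreeBoundedEdgeSets f (i + 1)) * ((i + 1) * D ^ 2) := by
  have key : ∀ H ∈ degreeBoundedEdgeSets f i, (E - i) ^ 2 ≤
      D ^ 2 * #{H' ∈ degreeBoundedEdgeSets f (i + 1) | ∃ e ∉ H, H' = insert e H} := by
    intro H hH
    obtain ⟨h1, h2, h3⟩ := mem_degreeBoundedEdgeSets.1 hH
    set U := deficient f H with hU
    have hUD : 2 * (E - i) ≤ #U * D := by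
      rw [two_mul_sub_eq_sum_deficient hf hH, ← smul_eq_mul]
      exact sum_le_card_nsmul _ _ _ fun v _ => (Nat.sub_le _ _).trans (hfD v)
    have hD2 : ∀ v, edgeDegree H v ≤ D := fun v => (h2 v).trans (hfD v)
    set P := U.offDiag.image Sym2.mk.uncurry with hP
    have hmemP : ∀ e ∈ P, ¬ e.IsDiag ∧ ∀ v ∈ e, v ∈ U := by
      intro e he
      obtain ⟨⟨a, b⟩, hab, rfl⟩ := mem_image.1 he
      rw [mem_offDiag] at hab
      simp only [Function.uncurry_apply_pair, Sym2.mk_isDiag_iff, Sym2.mem_iff, forall_eq_or_imp,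
        forall_eq]
      exact ⟨hab.2.2, hab.1, hab.2.1⟩
    have hPcard : 2 * #P = #U * #U - #U := by
      rw [hP, Sym2.two_mul_card_image_offDiag, offDiag_card]
    have hPH : #P ≤ #(P \ H) + #U * D := by
      rw [← card_sdiff_add_card_inter P H]
      refine Nat.add_le_add_left ((card_le_card fun e he => ?_).trans
        (card_filter_exists_mem_le H U hD2)) _
      rw [mem_inter] at he
      rw [mem_filter]
      refine ⟨he.2, ?_⟩
      induction e with
      | _ a b => exact ⟨a, (hmemP _ he.1).2 a (Sym2.mem_mk_left a b), Sym2.mem_mk_left a b⟩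
    have hle : #(P \ H) ≤
        #{H' ∈ degreeBoundedEdgeSets f (i + 1) | ∃ e ∉ H, H' = insert e H} := by
      refine card_le_card_of_injOn (fun e => insert e H) (fun e he => ?_) fun e he e' he' hee => ?_
      · rw [mem_coe, Finset.mem_sdiff] at he
        obtain ⟨hd, hv⟩ := hmemP e he.1
        rw [mem_coe, mem_filter, mem_degreeBoundedEdgeSets]
        refine ⟨⟨?_, fun v => ?_, ?_⟩, e, he.2, rfl⟩
        · simpa [hd] using h1
        · rw [edgeDegree_insert he.2]
          split_ifs with hve
          · have := hv v hve
            simp only [hU, deficient, mem_filter, mem_univ, true_and] at this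
            omega
          · exact h2 v
        · rw [card_insert_of_notMem he.2, h3]
      · rw [mem_coe, Finset.mem_sdiff] at he he'
        have : e ∈ insert e' H := by
          rw [← show insert e H = insert e' H from hee]
          exact mem_insert_self _ _
        exact (mem_insert.1 this).resolve_right he.2
    refine le_trans ?_ (Nat.mul_le_mul_left _ hle)
    rcases Nat.eq_zero_or_pos D with rfl | hDpos
    · have : E - i = 0 := by omega
      simp [this]
    have hu : 4 * D + 2 ≤ #U := by
      have : (4 * D + 2) * D ≤ #U * D := by nlinarith
      exact Nat.le_of_mul_le_mul_right this hDpos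
    -- Of the `#U (#U - 1) / 2` pairs at most `#U * D` are already edges; `#U ≥ 4D + 2` is exactly
    -- what leaves `#U² / 4`.
    have hu2 : #U ^ 2 ≤ 4 * #(P \ H) := by
      have h4 : 2 * #P + #U = #U * #U := by
        have := Nat.le_mul_self #U
        omega
      nlinarith
    have h5 : (2 * (E - i)) ^ 2 ≤ (#U * D) ^ 2 := Nat.pow_le_pow_left hUD 2
    nlinarith [Nat.mul_le_mul_left (D ^ 2) hu2]
  have h2 : #(degreeBoundedEdgeSets f i) * (E - i) ^ 2 ≤
      ∑ H ∈ degreeBoundedEdgeSets f i,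
        D ^ 2 * #{H' ∈ degreeBoundedEdgeSets f (i + 1) | ∃ e ∉ H, H' = insert e H} := by
    rw [← smul_eq_mul]
    exact card_nsmul_le_sum _ _ _ key
  have h3 := sum_card_bipartiteAbove_eq_sum_card_bipartiteBelow (s := degreeBoundedEdgeSets f i)
    (t := degreeBoundedEdgeSets f (i + 1)) (fun H H' => ∃ e ∉ H, H' = insert e H)
  simp only [bipartiteAbove, bipartiteBelow] at h3
  rw [← mul_sum, h3] at h2
  refine h2.trans ?_
  -- Each `H'` is reached only by erasing one of its `i + 1` edges.
  have h4 : ∑ H' ∈ degreeBoundedEdgeSets f (i + 1),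
      #{H ∈ degreeBoundedEdgeSets f i | ∃ e ∉ H, H' = insert e H} ≤
        #(degreeBoundedEdgeSets f (i + 1)) * (i + 1) := by
    rw [← smul_eq_mul]
    refine sum_le_card_nsmul _ _ _ fun H' hH' => ?_
    rw [← (mem_degreeBoundedEdgeSets.1 hH').2.2]
    refine le_trans (card_le_card (t := H'.image fun e => H'.erase e) fun H hH => ?_)
      card_image_le
    obtain ⟨-, e, he, rfl⟩ := mem_filter.1 hH
    exact mem_image.2 ⟨e, mem_insert_self _ _, by simp [he]⟩
  nlinarith [Nat.mul_le_mul_left (D ^ 2) h4]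

/-- One edge can be exchanged for two so as to raise the number of edges by one without
exceeding the prescribed degrees. -/
lemma exists_augmentation {f : V → ℕ} {D E i : ℕ} (hfD : ∀ v, f v ≤ D)
    (hf : ∑ v, f v = 2 * E) (hi : (2 * D + 2) * D < i) (hiE : i < E)
    {H : Finset (Sym2 V)} (hH : H ∈ degreeBoundedEdgeSets f i) :
    ∃ e₁ e₂ e₃ : Sym2 V, e₁ ∈ H ∧ e₂ ∉ H ∧ e₃ ∉ H ∧ e₂ ≠ e₃ ∧
      insert e₃ (insert e₂ (H.erase e₁)) ∈ degreeBoundedEdgeSets f (i + 1) := by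
  obtain ⟨h1, h2, h3⟩ := mem_degreeBoundedEdgeSets.1 hH
  have hD2 : ∀ v, edgeDegree H v ≤ D := fun v => (h2 v).trans (hfD v)
  have hsum := two_mul_sub_eq_sum_deficient hf hH
  -- The total deficiency is `2 * (E - i) ≥ 2`: either two vertices are deficient, or a single one
  -- lacks two edges and `u = v`.
  have huv : ∃ u v, ∀ w, edgeDegree H w + (if w = u then 1 else 0) + (if w = v then 1 else 0)
      ≤ f w := by
    have hne : (deficient f H).Nonempty := by
      rw [nonempty_iff_ne_empty]
      intro h
      rw [h, sum_empty] at hsum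
      omega
    obtain ⟨u, hu⟩ := hne
    by_cases hv : ∃ v ∈ deficient f H, v ≠ u
    · obtain ⟨v, hv, hvu⟩ := hv
      refine ⟨u, v, fun w => ?_⟩
      simp only [deficient, mem_filter, mem_univ, true_and] at hu hv
      have := h2 w
      split_ifs with hwu hwv hwv <;> subst_vars
      · exact absurd rfl hvu
      all_goals omega
    · push Not at hv
      have : deficient f H = {u} := eq_singleton_iff_unique_mem.2 ⟨hu, hv⟩
      rw [this, sum_singleton] at hsum
      refine ⟨u, u, fun w => ?_⟩
      have := h2 w
      split_ifs with hwu <;> subst_vars <;> omega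
  obtain ⟨u, v, huv⟩ := huv
  set nbhd : V → Finset V := fun u => insert u (univ.filter fun w => s(u, w) ∈ H) with hnbhd
  have hcardN : ∀ u, #(nbhd u) ≤ D + 1 := by
    intro u
    refine (card_insert_le _ _).trans (Nat.add_le_add_right ?_ 1)
    refine le_trans (card_le_card_of_injOn (fun w => s(u, w)) (fun w hw => ?_) fun w _ w' _ hww => ?_)
      (hD2 u)
    · simpa using hw
    · exact Sym2.congr_right.1 hww
  -- The two closed neighbourhoods have at most `2D + 2` vertices, hence meet at most `(2D + 2) * D`
  -- edges, fewer than `H` has.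
  have hexists : ∃ e ∈ H, ∀ w ∈ e, w ∉ nbhd u ∪ nbhd v := by
    by_contra! hcon
    have : #H ≤ (2 * D + 2) * D := by
      calc #H = #{e ∈ H | ∃ w ∈ nbhd u ∪ nbhd v, w ∈ e} := by
            rw [filter_true_of_mem]
            intro e he
            obtain ⟨w, hw, hw'⟩ := hcon e he
            exact ⟨w, hw', hw⟩
        _ ≤ #(nbhd u ∪ nbhd v) * D := card_filter_exists_mem_le H _ hD2
        _ ≤ (2 * D + 2) * D := by
            refine Nat.mul_le_mul_right D ((card_union_le _ _).trans ?_)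
            have := hcardN u
            have := hcardN v
            omega
    omega
  obtain ⟨e, he, hew⟩ := hexists
  induction e with
  | _ x y =>
    have hx := hew x (Sym2.mem_mk_left x y)
    have hy := hew y (Sym2.mem_mk_right x y)
    simp only [hnbhd, mem_union, mem_insert, mem_filter, mem_univ, true_and, not_or] at hx hy
    obtain ⟨⟨hxu, hux⟩, hxv, hvx⟩ := hx
    obtain ⟨⟨hyu, huy⟩, hyv, hvy⟩ := hy
    have hxy : x ≠ y := by simpa using h1 _ he
    have hne : s(u, x) ≠ s(v, y) := by
      simp only [ne_eq, Sym2.eq_iff, not_or, not_and]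
      exact ⟨fun _ => hxy, fun h => absurd h.symm hyu⟩
    have hne2 : s(u, x) ∉ H.erase s(x, y) := fun h => hux (mem_of_mem_erase h)
    have hne3 : s(v, y) ∉ insert s(u, x) (H.erase s(x, y)) := by
      rw [mem_insert, not_or]
      exact ⟨hne.symm, fun h => hvy (mem_of_mem_erase h)⟩
    -- Replacing `xy` by `ux` and `vy` preserves the degrees of `x` and `y`; only `u` and `v` gain.
    refine ⟨s(x, y), s(u, x), s(v, y), he, hux, hvy, hne, ?_⟩
    rw [mem_degreeBoundedEdgeSets]
    refine ⟨?_, fun w => ?_, ?_⟩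
    · intro e' he'
      rw [mem_insert, mem_insert] at he'
      rcases he' with rfl | rfl | he'
      · simpa using Ne.symm hyv
      · simpa using Ne.symm hxu
      · exact h1 _ (mem_of_mem_erase he')
    · rw [edgeDegree_insert hne3, edgeDegree_insert hne2]
      have hw1 := edgeDegree_erase he w
      refine le_trans ?_ (huv w)
      rw [← hw1]
      simp only [Sym2.mem_iff]
      split_ifs <;> subst_vars <;> simp_all
    · rw [card_insert_of_notMem hne3, card_insert_of_notMem hne2, card_erase_of_mem he, h3]
      omega

/-- Recording the three exchanged edges makes the augmentation reversible. The loss is polynomial in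
the number of vertices, which is affordable because this is used only for the last `k` edges, where
the greedy count breaks down. -/
lemma card_le_card_succ_mul {f : V → ℕ} {D E i : ℕ} (hfD : ∀ v, f v ≤ D)
    (hf : ∑ v, f v = 2 * E) (hi : (2 * D + 2) * D < i) (hiE : i < E) :
    #(degreeBoundedEdgeSets f i) ≤
      #(degreeBoundedEdgeSets f (i + 1)) * Fintype.card (Sym2 V) ^ 3 := by
  rcases (degreeBoundedEdgeSets f i).eq_empty_or_nonempty with h0 | ⟨H₀, hH₀⟩
  · simp [h0]
  have h : ∀ H ∈ degreeBoundedEdgeSets f i, ∃ e : Sym2 V × Sym2 V × Sym2 V,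
      e.1 ∈ H ∧ e.2.1 ∉ H ∧ e.2.2 ∉ H ∧ e.2.1 ≠ e.2.2 ∧
        insert e.2.2 (insert e.2.1 (H.erase e.1)) ∈ degreeBoundedEdgeSets f (i + 1) := by
    intro H hH
    obtain ⟨e₁, e₂, e₃, h⟩ := exists_augmentation hfD hf hi hiE hH
    exact ⟨(e₁, e₂, e₃), h⟩
  have : Nonempty (Sym2 V) := ⟨(h H₀ hH₀).choose.1⟩
  choose! φ hφ using h
  have hcard : #(degreeBoundedEdgeSets f (i + 1)) * Fintype.card (Sym2 V) ^ 3 =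
      #(degreeBoundedEdgeSets f (i + 1) ×ˢ (univ : Finset (Sym2 V × Sym2 V × Sym2 V))) := by
    rw [card_product, card_univ, Fintype.card_prod, Fintype.card_prod]
    ring
  rw [hcard]
  refine card_le_card_of_injOn
    (fun H => (insert (φ H).2.2 (insert (φ H).2.1 (H.erase (φ H).1)), φ H)) (fun H hH => ?_) ?_
  · rw [mem_coe, mem_product]
    exact ⟨(hφ H hH).2.2.2.2, mem_univ _⟩
  · have hrec : ∀ H ∈ degreeBoundedEdgeSets f i,
        insert (φ H).1 (((insert (φ H).2.2 (insert (φ H).2.1 (H.erase (φ H).1))).erase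
          (φ H).2.2).erase (φ H).2.1) = H := by
      intro H hH
      obtain ⟨ha, hb, hc, hd, -⟩ := hφ H hH
      rw [erase_insert, erase_insert, insert_erase ha]
      · exact fun h => hb (mem_of_mem_erase h)
      · rw [mem_insert, not_or]
        exact ⟨hd.symm, fun h => hc (mem_of_mem_erase h)⟩
    intro H hH H' hH' hHH'
    rw [Prod.mk.injEq] at hHH'
    rw [← hrec H hH, ← hrec H' hH', hHH'.1, hHH'.2]

/-- A lower bound for the number of graphs with given bounded degrees. -/
theorem factorial_le_card_degreeBounded {f : V → ℕ} {D E k : ℕ} (hD : 0 < D) (hfD : ∀ v, f v ≤ D)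
    (hf : ∑ v, f v = 2 * E) (hk : D * (2 * D + 1) ≤ k) (hkE : (2 * D + 2) * D + k < E) :
    E.factorial ≤ #(degreeBoundedEdgeSets f E) *
      (k.factorial ^ 2 * D ^ (2 * E) * (Fintype.card (Sym2 V)) ^ (3 * k)) := by
  -- The greedy inequality telescoped from the empty graph; `i + k ≤ E` keeps enough deficiency at
  -- each step.
  have h1 : ∀ i, i + k ≤ E → (E.factorial) ^ 2 ≤
      #(degreeBoundedEdgeSets f i) * (((E - i).factorial) ^ 2 * D ^ (2 * i) * i.factorial) := by
    intro i
    induction i with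
    | zero =>
      intro _
      have : 0 < #(degreeBoundedEdgeSets f 0) := by
        rw [card_pos]
        exact ⟨∅, mem_degreeBoundedEdgeSets.2 (by simp [edgeDegree])⟩
      simpa using Nat.le_mul_of_pos_left _ this
    | succ i ih =>
      intro hi
      have h := card_mul_sq_le_card_succ hfD hf (i := i) (by omega)
      refine (ih (by omega)).trans ?_
      obtain ⟨j, hj⟩ : ∃ j, E - i = j + 1 := ⟨E - i - 1, by omega⟩
      have hj' : E - (i + 1) = j := by omega
      rw [hj] at h ⊢
      rw [hj', Nat.factorial_succ, Nat.factorial_succ]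
      calc #(degreeBoundedEdgeSets f i) * (((j + 1) * j.factorial) ^ 2 * D ^ (2 * i) * i.factorial)
          = (#(degreeBoundedEdgeSets f i) * (j + 1) ^ 2) *
            (j.factorial ^ 2 * D ^ (2 * i) * i.factorial) := by ring
        _ ≤ (#(degreeBoundedEdgeSets f (i + 1)) * ((i + 1) * D ^ 2)) *
            (j.factorial ^ 2 * D ^ (2 * i) * i.factorial) := Nat.mul_le_mul_right _ h
        _ = _ := by ring
  have h2 : ∀ j, j ≤ k → #(degreeBoundedEdgeSets f (E - k)) ≤
      #(degreeBoundedEdgeSets f (E - k + j)) * Fintype.card (Sym2 V) ^ (3 * j) := by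
    intro j
    induction j with
    | zero => simp
    | succ j ih =>
      intro hj
      refine (ih (by omega)).trans ?_
      have h := card_le_card_succ_mul hfD hf (i := E - k + j) (by omega) (by omega)
      calc _ ≤ (#(degreeBoundedEdgeSets f (E - k + j + 1)) * Fintype.card (Sym2 V) ^ 3) *
            Fintype.card (Sym2 V) ^ (3 * j) := Nat.mul_le_mul_right _ h
        _ = _ := by rw [← add_assoc]; ring
  have h3 := h1 (E - k) (by omega)
  have h4 := h2 k le_rfl
  rw [show E - (E - k) = k by omega] at h3
  rw [show E - k + k = E by omega] at h4
  have h5 : (E - k).factorial ≤ E.factorial := Nat.factorial_le (by omega)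
  have h6 : D ^ (2 * (E - k)) ≤ D ^ (2 * E) := Nat.pow_le_pow_right hD (by omega)
  -- `h3` has `E!²` on the left and `(E - k)! ≤ E!` on the right, so one factor `E!` cancels.
  refine Nat.le_of_mul_le_mul_right ?_ E.factorial_pos
  calc E.factorial * E.factorial = E.factorial ^ 2 := by ring
    _ ≤ _ := h3
    _ ≤ (#(degreeBoundedEdgeSets f E) * Fintype.card (Sym2 V) ^ (3 * k)) *
        (k.factorial ^ 2 * D ^ (2 * E) * E.factorial) := by gcongr
    _ = _ := by ring

end DegreeBounded

/-! ### Edge sets concentrated on few pairs of classes -/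

section Spread

open Finset

variable {V : Type*} [Fintype V] [DecidableEq V]

/-- Whenever the vertices are distributed to `M` classes of size at most `s`, the edges of `H`
lie between more than `X` pairs of classes. -/
def IsSpread (H : Finset (Sym2 V)) (M s X : ℕ) : Prop :=
  ∀ g : V → Fin M, (∀ i, #{v | g v = i} ≤ s) → X < #(H.image (Sym2.map g))

/-- Lists with repetition replace sets of size at most `X`, so that the choices are counted by a
plain power. An element of `T` fills the unused entries. -/
lemma exists_subset_image_univ {α : Type*} [DecidableEq α] {T : Finset α} {X : ℕ}
    (hT : T.Nonempty) (hX : #T ≤ X) : ∃ τ : Fin X → α, T ⊆ univ.image τ := by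
  obtain ⟨φ⟩ : Nonempty (T ↪ Fin X) :=
    Function.Embedding.nonempty_of_card_le (by simpa using hX)
  have : Nonempty T := hT.to_subtype
  refine ⟨fun i => (Function.invFun φ i : T), fun t ht => ?_⟩
  rw [mem_image]
  exact ⟨φ ⟨t, ht⟩, mem_univ _, by rw [Function.leftInverse_invFun φ.injective]⟩

lemma card_map_eq_le_sq {M s : ℕ} {g : V → Fin M} (hg : ∀ i, #{v | g v = i} ≤ s)
    (p : Sym2 (Fin M)) : #{e : Sym2 V | Sym2.map g e = p} ≤ s ^ 2 := by
  induction p with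
  | _ a b =>
    calc _ ≤ #(((univ.filter fun v => g v = a) ×ˢ univ.filter fun v => g v = b).image Sym2.mk.uncurry) := by
          refine card_le_card fun e he => ?_
          induction e with
          | _ x y =>
            simp only [mem_filter, mem_univ, true_and, Sym2.map_mk, Sym2.eq_iff] at he
            rw [mem_image]
            rcases he with he | he
            · exact ⟨(x, y), by simp [he], rfl⟩
            · exact ⟨(y, x), by simp [he], Sym2.eq_swap⟩
      _ ≤ #{v | g v = a} * #{v | g v = b} := card_image_le.trans (card_product _ _).le
      _ ≤ s ^ 2 := by
          rw [sq]
          exact Nat.mul_le_mul (hg a) (hg b)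

open Classical in
/-- Few edge sets fail to be spread over many pairs of classes. -/
theorem card_not_isSpread_mul_factorial_le {M s X E : ℕ} (hE : 0 < E) :
    #{H : Finset (Sym2 V) | #H = E ∧ ¬ IsSpread H M s X} * E.factorial ≤
      M ^ Fintype.card V * Fintype.card (Sym2 (Fin M)) ^ X * (X * s ^ 2) ^ E := by
  set I : Finset ((V → Fin M) × (Fin X → Sym2 (Fin M))) := {p | ∀ i, #{v | p.1 v = i} ≤ s}
  set S : (V → Fin M) × (Fin X → Sym2 (Fin M)) → Finset (Sym2 V) :=
    fun p => {e | Sym2.map p.1 e ∈ univ.image p.2}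
  -- A set that is not spread is determined by a map `g`, a list of pairs covering its image, and a
  -- choice of `E` edges in the preimage.
  have hsub : (univ.filter fun H : Finset (Sym2 V) => #H = E ∧ ¬ IsSpread H M s X) ⊆
      (I.biUnion fun p => (S p).powersetCard E) := by
    intro H hH
    simp only [IsSpread, mem_filter, mem_univ, true_and, not_forall, not_lt] at hH
    obtain ⟨hHE, g, hg, hle⟩ := hH
    have hne : (H.image (Sym2.map g)).Nonempty := by
      rw [image_nonempty, ← card_pos]
      omega
    obtain ⟨τ, hτ⟩ := exists_subset_image_univ hne hle
    rw [mem_biUnion]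
    refine ⟨(g, τ), by simpa [I] using hg, mem_powersetCard.2 ⟨fun e he => ?_, hHE⟩⟩
    simp only [S, mem_filter, mem_univ, true_and]
    exact hτ (mem_image_of_mem _ he)
  have hS : ∀ p ∈ I, #(S p) ≤ X * s ^ 2 := by
    intro p hp
    have hp : ∀ i, #{v | p.1 v = i} ≤ s := by simpa [I] using hp
    have : S p ⊆ univ.biUnion fun j => univ.filter fun e : Sym2 V => Sym2.map p.1 e = p.2 j := by
      intro e he
      simp only [S, mem_filter, mem_univ, true_and, mem_image] at he
      obtain ⟨j, hj⟩ := he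
      simp only [mem_biUnion, mem_filter, mem_univ, true_and]
      exact ⟨j, hj.symm⟩
    refine (card_le_card this).trans ?_
    have h := card_biUnion_le_card_mul univ
      (fun j => ({e : Sym2 V | Sym2.map p.1 e = p.2 j} : Finset _)) (s ^ 2)
      fun j _ => card_map_eq_le_sq hp _
    simpa using h
  have hI : #I ≤ M ^ Fintype.card V * Fintype.card (Sym2 (Fin M)) ^ X := by
    refine (card_le_univ I).trans (le_of_eq ?_)
    simp
  calc _ ≤ (∑ p ∈ I, #((S p).powersetCard E)) * E.factorial :=
        Nat.mul_le_mul_right _ ((card_le_card hsub).trans card_biUnion_le)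
    _ = ∑ p ∈ I, (#(S p)).descFactorial E := by
        rw [sum_mul]
        refine sum_congr rfl fun p _ => ?_
        rw [card_powersetCard, Nat.descFactorial_eq_factorial_mul_choose, mul_comm]
    _ ≤ ∑ p ∈ I, (X * s ^ 2) ^ E := sum_le_sum fun p hp =>
        (Nat.descFactorial_le_pow _ _).trans (Nat.pow_le_pow_left (hS p hp) E)
    _ = #I * (X * s ^ 2) ^ E := by rw [sum_const, smul_eq_mul]
    _ ≤ _ := Nat.mul_le_mul_right _ hI

end Spread

/-! ### Finiteness and lower bounds for ordered Ramsey numbers -/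

section Ramsey

open Finset

/-- The finite Ramsey theorem for ordered pairs. -/
lemma exists_homogeneous_of_card_le (a b : ℕ) : ∃ N, ∀ (A : Finset ℕ) (r : ℕ → ℕ → Prop),
    N ≤ #A → (∃ B ⊆ A, #B = a ∧ ∀ x ∈ B, ∀ y ∈ B, x < y → r x y) ∨
      ∃ B ⊆ A, #B = b ∧ ∀ x ∈ B, ∀ y ∈ B, x < y → ¬ r x y := by
  classical
  induction a generalizing b with
  | zero => exact ⟨0, fun A r _ => Or.inl ⟨∅, by simp⟩⟩
  | succ a iha =>
    induction b with
    | zero => exact ⟨0, fun A r _ => Or.inr ⟨∅, by simp⟩⟩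
    | succ b ihb =>
      obtain ⟨N₁, h₁⟩ := iha (b + 1)
      obtain ⟨N₂, h₂⟩ := ihb
      refine ⟨N₁ + N₂ + 1, fun A r hA => ?_⟩
      have hne : A.Nonempty := by
        rw [← card_pos]
        omega
      -- With the minimum as pivot, only the values `r x y` going upwards from `x` matter when it is
      -- added to a homogeneous set.
      obtain ⟨x, hx, hmin⟩ : ∃ x ∈ A, ∀ y ∈ A, x ≤ y :=
        ⟨A.min' hne, A.min'_mem hne, fun y hy => A.min'_le y hy⟩
      have extend : ∀ (p : ℕ → ℕ → Prop) (B : Finset ℕ) (c : ℕ),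
          B ⊆ (A.erase x).filter (p x) → #B = c →
          (∀ y ∈ B, ∀ z ∈ B, y < z → p y z) →
          ∃ B ⊆ A, #B = c + 1 ∧ ∀ y ∈ B, ∀ z ∈ B, y < z → p y z := by
        intro p B c hB hc hp
        have hB' : ∀ y ∈ B, y ≠ x ∧ y ∈ A ∧ p x y := fun y hy => by
          have := hB hy
          rw [mem_filter, mem_erase] at this
          tauto
        refine ⟨insert x B, ?_, ?_, ?_⟩
        · rw [insert_subset_iff]
          exact ⟨hx, fun y hy => (hB' y hy).2.1⟩
        · rw [card_insert_of_notMem fun h => (hB' x h).1 rfl, hc]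
        · intro y hy z hz hyz
          rw [mem_insert] at hy hz
          rcases hy with rfl | hy
          · rcases hz with rfl | hz
            · exact absurd hyz (lt_irrefl _)
            · exact (hB' z hz).2.2
          · rcases hz with rfl | hz
            · exact absurd hyz (not_lt.2 (hmin y (hB' y hy).2.1))
            · exact hp y hy z hz hyz
      have hcard := card_filter_add_card_filter_not (s := A.erase x) (r x)
      rw [card_erase_of_mem hx] at hcard
      by_cases hN : N₁ ≤ #((A.erase x).filter (r x))
      · rcases h₁ _ r hN with ⟨B, hB, hc, hr⟩ | ⟨B, hB, hc, hr⟩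
        · exact Or.inl (extend r B a hB hc hr)
        · exact Or.inr ⟨B, hB.trans ((filter_subset _ _).trans (erase_subset _ _)), hc, hr⟩
      · rcases h₂ ((A.erase x).filter fun y => ¬ r x y) r (by omega) with
          ⟨B, hB, hc, hr⟩ | ⟨B, hB, hc, hr⟩
        · exact Or.inl ⟨B, hB.trans ((filter_subset _ _).trans (erase_subset _ _)), hc, hr⟩
        · exact Or.inr (extend (fun y z => ¬ r y z) B b (by convert hB) hc hr)

/-- The ordered Ramsey number of a finite ordered graph is finite. -/
theorem OrderedGraph.exists_arrows {V : Type*} [Fintype V] (𝒢 : OrderedGraph V) :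
    ∃ N, 𝒢.Arrows N := by
  classical
  obtain ⟨N, hN⟩ := exists_homogeneous_of_card_le (Fintype.card V) (Fintype.card V)
  refine ⟨N, fun c => ?_⟩
  set r : ℕ → ℕ → Prop := fun x y => ∃ (hx : x < N) (hy : y < N)
    (h : (⟨x, hx⟩ : Fin N) ≠ ⟨y, hy⟩), c.get _ _ h = true
  have main : ∀ b : Bool, (∃ B ⊆ range N, #B = Fintype.card V ∧
      ∀ x (hx : x < N) y (hy : y < N), x ∈ B → y ∈ B → x < y →
        ∀ h : (⟨x, hx⟩ : Fin N) ≠ ⟨y, hy⟩, c.get _ _ h = b) →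
      𝒢.IsContained ⟨c.labelGraph b, inferInstance⟩ := by
    rintro b ⟨B, hB, hcard, hcol⟩
    let := 𝒢.order
    set φ := (Fintype.orderIsoFinOfCardEq V rfl).symm.trans (B.orderIsoOfFin hcard) with hφ
    have hlt : ∀ v, (φ v : ℕ) < N := fun v => mem_range.1 (hB (φ v).2)
    have hadj : ∀ u v, 𝒢.order.lt u v →
        (c.labelGraph b).Adj ⟨φ u, hlt u⟩ ⟨φ v, hlt v⟩ := by
      intro u v huv
      have huv' : φ u < φ v := φ.strictMono huv
      have hne : (⟨φ u, hlt u⟩ : Fin N) ≠ ⟨φ v, hlt v⟩ := by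
        intro h
        rw [Fin.mk.injEq] at h
        exact huv'.ne (Subtype.ext h)
      rw [SimpleGraph.TopEdgeLabeling.labelGraph_adj]
      exact ⟨hne, hcol _ _ _ _ (φ u).2 (φ v).2 huv' hne⟩
    refine ⟨fun v => ⟨φ v, hlt v⟩, fun u v huv => ?_, fun u v huv => ?_⟩
    · exact φ.strictMono huv
    · rcases lt_trichotomy u v with h | h | h
      · exact hadj u v h
      · exact absurd h huv.ne
      · exact (hadj v u h).symm
  rcases hN (range N) r (by simp) with ⟨B, hB, hcard, hr⟩ | ⟨B, hB, hcard, hr⟩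
  · refine ⟨true, main true ⟨B, hB, hcard, fun x hx y hy hxB hyB hxy h => ?_⟩⟩
    obtain ⟨_, _, _, h'⟩ := hr x hxB y hyB hxy
    exact h'
  · refine ⟨false, main false ⟨B, hB, hcard, fun x hx y hy hxB hyB hxy h => ?_⟩⟩
    have := hr x hxB y hyB hxy
    rw [← Bool.not_eq_true]
    exact fun h' => this ⟨hx, hy, h, h'⟩

/-- The number of monotone maps to a finite chain. -/
lemma card_monotone_le {V : Type*} [Fintype V] (o : LinearOrder V) (M : ℕ) :
    Nat.card {g : V → Fin M // ∀ u v, o.lt u v → g u ≤ g v} ≤ (Fintype.card V + M).choose M := by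
  let := o
  let F : {g : V → Fin M // ∀ u v, o.lt u v → g u ≤ g v} → Sym (Fin M) (Fintype.card V) :=
    fun g => ⟨univ.val.map g.1, by simp⟩
  have hF : Function.Injective F := by
    rintro ⟨g, hg⟩ ⟨g', hg'⟩ h
    have h' : (univ : Finset V).val.map g = univ.val.map g' := congrArg Subtype.val h
    -- A monotone map lists its values in sorted order, so it is recovered from their multiset.
    rw [← sort_eq (univ : Finset V) (· ≤ ·), Multiset.map_coe, Multiset.map_coe,
      Multiset.coe_eq_coe] at h'
    have hsorted : ∀ g : V → Fin M, (∀ u v, o.lt u v → g u ≤ g v) →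
        (((univ : Finset V).sort (· ≤ ·)).map g).Pairwise (· ≤ ·) := by
      intro g hg
      rw [List.pairwise_map]
      refine (pairwise_sort (univ : Finset V) (· ≤ ·)).imp fun {u v} huv => ?_
      rcases huv.lt_or_eq with h | rfl
      · exact hg u v h
      · exact le_rfl
    have heq := h'.eq_of_pairwise (fun a b _ _ => le_antisymm) (hsorted g hg) (hsorted g' hg')
    rw [List.map_inj_left] at heq
    ext1
    funext v
    exact heq v (by simp)
  refine (Nat.card_le_card_of_injective F hF).trans ?_
  rw [Nat.card_eq_fintype_card, Sym.card_sym_eq_choose, Fintype.card_fin, ← Nat.choose_symm_add]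
  exact Nat.choose_le_choose _ (by omega)

/-- Counting form of the fact that a random colouring gives all of `S` the colour `b` with
probability `2 ^ (-#S)`. -/
lemma card_constant_on_mul {α : Type*} [Fintype α] [DecidableEq α] (S : Finset α) (b : Bool) :
    #{c : α → Bool | ∀ e ∈ S, c e = b} * 2 ^ #S = 2 ^ Fintype.card α := by
  have : (univ.filter fun c : α → Bool => ∀ e ∈ S, c e = b) =
      Fintype.piFinset fun e => if e ∈ S then {b} else univ := by
    ext c
    simp only [mem_filter, mem_univ, true_and, Fintype.mem_piFinset]
    refine forall_congr' fun e => ?_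
    split_ifs with h <;> simp [h]
  rw [this, Fintype.card_piFinset]
  have h2 : ∀ e, #(if e ∈ S then {b} else (univ : Finset Bool)) = if e ∈ S then 1 else 2 := by
    intro e
    split_ifs <;> simp
  simp only [h2]
  rw [prod_ite, prod_const_one, one_mul, prod_const, filter_not, filter_mem_eq_inter, univ_inter,
    ← compl_eq_univ_sdiff, ← pow_add, card_compl_add_card]

/-- A blown-up random coloring shows that spread graphs have large ordered Ramsey numbers. -/
theorem not_arrows_of_isSpread {V : Type*} [Fintype V] [DecidableEq V] {G : SimpleGraph V}
    [Fintype G.edgeSet] (o : LinearOrder V) {M s X R : ℕ} (hG : IsSpread G.edgeFinset M s X)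
    (hX : 2 * (Fintype.card V + M).choose M ≤ 2 ^ X) (hR : R ≤ M * s) :
    ¬ (⟨G, o⟩ : OrderedGraph V).Arrows R := by
  classical
  intro harrow
  set I : Finset (V → Fin M) :=
    univ.filter fun g => (∀ u v, o.lt u v → g u ≤ g v) ∧ ∀ i, #{v | g v = i} ≤ s
  have hI : #I ≤ (Fintype.card V + M).choose M := by
    refine le_trans ?_ (card_monotone_le o M)
    rw [Nat.card_eq_fintype_card, Fintype.card_subtype]
    exact card_le_card fun g hg => by
      simp only [I, mem_filter, mem_univ, true_and] at hg ⊢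
      exact hg.1
  have hdiv : ∀ x : Fin R, x.1 / s < M := fun x =>
    Nat.div_lt_of_lt_mul (by rw [mul_comm]; exact x.2.trans_le hR)
  set block : Fin R → Fin M := fun x => ⟨x.1 / s, hdiv x⟩
  have hcover : (univ : Finset (Sym2 (Fin M) → Bool)) ⊆
      (I ×ˢ (univ : Finset Bool)).biUnion fun p =>
        univ.filter fun c => ∀ e ∈ G.edgeFinset.image (Sym2.map p.1), c e = p.2 := by
    intro c _
    -- Edges inside a block take the colour of a diagonal element of `Sym2 (Fin M)`, which `c`
    -- colours as well.
    let col : SimpleGraph.TopEdgeLabeling (Fin R) Bool := fun e => c (Sym2.map block e.1)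
    obtain ⟨b, f, hf, hadj⟩ := harrow col
    have hmono : ∀ u v, o.lt u v → f u < f v := hf
    have hinj : Function.Injective f := by
      intro u v huv
      by_contra hne
      rcases (@lt_or_gt_of_ne V o u v hne) with h | h
      · exact (hmono u v h).ne huv
      · exact (hmono v u h).ne huv.symm
    rw [mem_biUnion]
    refine ⟨(block ∘ f, b), ?_, ?_⟩
    · simp only [I, mem_product, mem_filter, mem_univ, true_and, and_true]
      refine ⟨fun u v huv => ?_, fun i => ?_⟩
      · exact Nat.div_le_div_right (hmono u v huv).le
      · have : #(Finset.Ico (i.1 * s) (i.1 * s + s)) = s := by simp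
        rw [← this]
        refine card_le_card_of_injOn (fun v => (f v).1) (fun v hv => ?_) fun u _ v _ huv =>
          hinj (Fin.ext huv)
        have hs : 0 < s := by
          rcases Nat.eq_zero_or_pos s with rfl | h
          · have := (f v).2
            omega
          · exact h
        simp only [coe_filter, mem_univ, true_and, Set.mem_ofPred_eq] at hv
        have hv' : (f v).1 / s = i.1 := congrArg Fin.val hv
        rw [mem_coe, Finset.mem_Ico, ← hv']
        exact ⟨Nat.div_mul_le_self _ _, Nat.lt_div_mul_add hs⟩
    · simp only [mem_filter, mem_univ, true_and, mem_image, forall_exists_index, and_imp,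
        forall_apply_eq_imp_iff₂]
      intro e he
      induction e with
      | _ x y =>
        rw [SimpleGraph.mem_edgeFinset, SimpleGraph.mem_edgeSet] at he
        have hxy : (col.labelGraph b).Adj (f x) (f y) := hadj x y he
        obtain ⟨h, h'⟩ := (SimpleGraph.TopEdgeLabeling.labelGraph_adj _ _).1 hxy
        exact h'
  have hcard := (card_le_card hcover).trans card_biUnion_le
  rw [card_univ, Fintype.card_fun, Fintype.card_bool] at hcard
  set m := Fintype.card (Sym2 (Fin M))
  -- Union bound: spreading is strict, so each image has at least `X + 1` pairs, one more than `hX`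
  -- can pay for.
  have hbound : 2 ^ m * 2 ^ (X + 1) ≤ #I * 2 * 2 ^ m := by
    calc 2 ^ m * 2 ^ (X + 1) ≤ _ := Nat.mul_le_mul_right _ hcard
      _ ≤ #(I ×ˢ (univ : Finset Bool)) • 2 ^ m := by
          rw [sum_mul]
          refine sum_le_card_nsmul _ _ _ fun p hp => ?_
          simp only [I, mem_product, mem_filter, mem_univ, true_and, and_true] at hp
          rw [← card_constant_on_mul (G.edgeFinset.image (Sym2.map p.1)) p.2]
          exact Nat.mul_le_mul_left _ (Nat.pow_le_pow_right two_pos (hG p.1 hp.2))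
      _ = #I * 2 * 2 ^ m := by simp [card_product]
  have h2m : 0 < 2 ^ m := by positivity
  have h3 : 2 ^ (X + 1) ≤ #I * 2 :=
    Nat.le_of_mul_le_mul_right (by rw [mul_comm]; exact hbound) h2m
  have h4 : 0 < 2 ^ X := by positivity
  rw [pow_succ] at h3
  omega

/-- Finiteness of the Ramsey number is essential here: the infimum of an empty set of naturals would
be `0`. -/
theorem lt_minOrderedRamsey_of_isSpread {V : Type*} [Fintype V] [DecidableEq V]
    [Nonempty (LinearOrder V)] {G : SimpleGraph V} [Fintype G.edgeSet] {M s X : ℕ}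
    (hG : IsSpread G.edgeFinset M s X) (hX : 2 * (Fintype.card V + M).choose M ≤ 2 ^ X) :
    M * s < minOrderedRamsey G := by
  refine Nat.succ_le_of_lt (lt_of_lt_of_le (Nat.lt_succ_self _) (le_ciInf fun o => ?_))
  by_contra! h
  exact not_arrows_of_isSpread o hG hX (Nat.lt_succ_iff.1 h)
    (Nat.sInf_mem (OrderedGraph.exists_arrows ⟨G, o⟩))

lemma minOrderedRamsey_le_ramsey {V : Type*} (G : SimpleGraph V) (o : LinearOrder V) :
    minOrderedRamsey G ≤ OrderedGraph.ramsey ⟨G, o⟩ :=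
  ciInf_le (OrderBot.bddBelow _) o

end Ramsey

/-! ### Counting `ρ`-regular graphs and passing to probabilities -/

section RealRegular

open Finset

lemma edgeDegree_edgeFinset {V : Type*} [Fintype V] [DecidableEq V] (G : SimpleGraph V)
    [Fintype G.edgeSet] (v : V) [Fintype (G.neighborSet v)] :
    edgeDegree G.edgeFinset v = G.degree v := by
  classical
  rw [← SimpleGraph.card_incidenceFinset_eq_degree, SimpleGraph.incidenceFinset_eq_filter]
  unfold edgeDegree
  congr! 2

/-- With `E` edges the degrees sum to `∑ v, f v`, so none of the upper bounds has slack. -/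
lemma edgeDegree_eq_of_mem_degreeBoundedEdgeSets {V : Type*} [Fintype V] [DecidableEq V]
    {f : V → ℕ} {E : ℕ} (hf : ∑ v, f v = 2 * E) {H : Finset (Sym2 V)}
    (hH : H ∈ degreeBoundedEdgeSets f E) (v : V) : edgeDegree H v = f v := by
  obtain ⟨h1, h2, h3⟩ := mem_degreeBoundedEdgeSets.1 hH
  refine (sum_eq_sum_iff_of_le fun v _ => h2 v).1 ?_ v (mem_univ v)
  rw [hf, sum_edgeDegree h1, h3]

lemma isRealRegular_iff {n : ℕ} {ρ : ℝ} {G : SimpleGraph (Fin n)} [Fintype G.edgeSet] :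
    IsRealRegular ρ G ↔ (∀ v, (edgeDegree G.edgeFinset v : ℤ) = ⌊ρ⌋ ∨
      (edgeDegree G.edgeFinset v : ℤ) = ⌈ρ⌉) ∧ 2 * (#G.edgeFinset : ℤ) = ⌈ρ * n⌉ := by
  classical
  simp only [IsRealRegular, edgeDegree_edgeFinset]
  congr! 5
  ext e
  simp only [SimpleGraph.mem_edgeFinset]

open Classical in
/-- A lower bound for the number of `ρ`-regular graphs. -/
theorem factorial_le_card_isRealRegular {n D E : ℕ} {ρ : ℝ} (hρ : 0 < ρ) (hρD : ρ + 1 ≤ D)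
    (hE : 2 * (E : ℤ) = ⌈ρ * n⌉) (hlarge : (2 * D + 2) * D + D * (2 * D + 1) < E) :
    E.factorial ≤ #{G : SimpleGraph (Fin n) | IsRealRegular ρ G} *
      ((D * (2 * D + 1)).factorial ^ 2 * D ^ (2 * E) *
        (Fintype.card (Sym2 (Fin n))) ^ (3 * (D * (2 * D + 1)))) := by
  set d := ⌊ρ⌋₊ with hd
  have hdρ : (d : ℝ) ≤ ρ := Nat.floor_le hρ.le
  have hρd : ρ < d + 1 := Nat.lt_floor_add_one ρ
  have hDpos : 0 < D := by
    have : (0 : ℝ) < D := by linarith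
    exact_mod_cast this
  have hdD : d + 1 ≤ D := by
    have : (d : ℝ) + 1 ≤ D := by linarith
    exact_mod_cast this
  have hn0 : (0 : ℝ) ≤ n := n.cast_nonneg
  have hlow : d * n ≤ 2 * E := by
    have h : ((d * n : ℕ) : ℝ) ≤ (⌈ρ * n⌉ : ℝ) := by
      push_cast
      exact (mul_le_mul_of_nonneg_right hdρ hn0).trans (Int.le_ceil _)
    rw [← hE] at h
    exact_mod_cast h
  have hup : 2 * E ≤ (d + 1) * n := by
    have h : ⌈ρ * n⌉ ≤ (((d + 1) * n : ℕ) : ℤ) := by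
      rw [Int.ceil_le]
      push_cast
      exact mul_le_mul_of_nonneg_right hρd.le hn0
    rw [← hE] at h
    exact_mod_cast h
  obtain ⟨h, hh⟩ : ∃ h, 2 * E = d * n + h := ⟨2 * E - d * n, by omega⟩
  have hhn : h ≤ n := by
    have : (d + 1) * n = d * n + n := by ring
    omega
  -- Fixing one degree sequence, with the first `h` vertices of degree `d + 1`, already yields
  -- enough graphs.
  set f : Fin n → ℕ := fun v => d + if v.1 < h then 1 else 0 with hf
  have hsum : ∑ v, f v = 2 * E := by
    rw [hf, sum_add_distrib, sum_const, card_univ, Fintype.card_fin, smul_eq_mul, ← card_filter,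
      Fin.card_filter_val_lt, min_eq_right hhn, hh, mul_comm]
  refine (factorial_le_card_degreeBounded hDpos (f := f) (fun v => ?_) hsum le_rfl hlarge).trans
    (Nat.mul_le_mul_right _ ?_)
  · simp only [hf]
    split_ifs <;> omega
  refine card_le_card_of_injOn (fun H => SimpleGraph.fromEdgeSet (H : Set (Sym2 (Fin n))))
    (fun H hH => ?_) fun H hH H' hH' hHH => ?_
  · have hdeg := edgeDegree_eq_of_mem_degreeBoundedEdgeSets hsum hH
    obtain ⟨h1, -, h3⟩ := mem_degreeBoundedEdgeSets.1 hH
    have hfin : (SimpleGraph.fromEdgeSet (H : Set (Sym2 (Fin n)))).edgeFinset = H := by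
      ext e
      rw [SimpleGraph.mem_edgeFinset, SimpleGraph.edgeSet_fromEdgeSet]
      simp only [Set.mem_sdiff, mem_coe]
      exact ⟨fun he => he.1, fun he => ⟨he, h1 e he⟩⟩
    suffices hreg : IsRealRegular ρ (SimpleGraph.fromEdgeSet (H : Set (Sym2 (Fin n)))) by
      simpa using hreg
    rw [isRealRegular_iff, hfin, h3]
    refine ⟨fun v => ?_, hE⟩
    have hfl : ⌊ρ⌋ = (d : ℤ) := (Int.natCast_floor_eq_floor hρ.le).symm
    rw [hdeg, hfl]
    by_cases hv : v.1 < h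
    · right
      -- If `ρ` were the integer `d`, then `2 * E = d * n` and `h = 0`, leaving no vertex of degree
      -- `d + 1`.
      have hlt : (d : ℝ) < ρ := by
        by_contra hcon
        have heq : ρ = d := le_antisymm (not_lt.1 hcon) hdρ
        have : ⌈ρ * n⌉ = ((d * n : ℕ) : ℤ) := by
          rw [heq]
          exact_mod_cast Int.ceil_natCast (R := ℝ) (d * n)
        rw [← hE] at this
        have : 2 * E = d * n := by exact_mod_cast this
        omega
      have hce : ⌈ρ⌉ = (d : ℤ) + 1 := by
        rw [Int.ceil_eq_iff]
        push_cast
        constructor <;> linarith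
      rw [hce]
      simp [hf, hv]
    · left
      simp [hf, hv]
  · have h1 := (mem_degreeBoundedEdgeSets.1 hH).1
    have h1' := (mem_degreeBoundedEdgeSets.1 hH').1
    have := congrArg SimpleGraph.edgeSet hHH
    simp only [SimpleGraph.edgeSet_fromEdgeSet] at this
    ext e
    have he := Set.ext_iff.1 this e
    simp only [Set.mem_sdiff, mem_coe] at he
    exact ⟨fun h => (he.1 ⟨h, h1 e h⟩).1, fun h => (he.2 ⟨h, h1' e h⟩).1⟩

open Classical in
lemma card_isRealRegular_not_isSpread_le {n E M s X : ℕ} {ρ : ℝ} (hE : 2 * (E : ℤ) = ⌈ρ * n⌉) :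
    #{G : SimpleGraph (Fin n) | IsRealRegular ρ G ∧ ¬ IsSpread G.edgeFinset M s X} ≤
      #{H : Finset (Sym2 (Fin n)) | #H = E ∧ ¬ IsSpread H M s X} := by
  refine card_le_card_of_injOn (fun G => G.edgeFinset) (fun G hG => ?_) fun G _ G' _ h => ?_
  · simp only [coe_filter, mem_univ, true_and, Set.mem_ofPred_eq] at hG ⊢
    refine ⟨?_, hG.2⟩
    have h := (isRealRegular_iff.1 hG.1).2
    omega
  · exact SimpleGraph.edgeFinset_inj.1 h

/-- A singleton of graphs is the preimage of a singleton under `Adj`. This allows `uniformOn` to be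
evaluated as a ratio of cardinalities. -/
instance {V : Type*} [Countable V] : MeasurableSingletonClass (SimpleGraph V) where
  measurableSet_singleton G :=
    ⟨{G.Adj}, measurableSet_singleton _, by ext G'; simp⟩

open Classical in
/-- If the graphs without the property `A` form a vanishing proportion of all the graphs with
the property `P`, then almost all of these have the property `A`. -/
lemma tendsto_uniformOn_of_card_le {l : Filter ℕ} {P A : (n : ℕ) → SimpleGraph (Fin n) → Prop}
    {q : ℕ → ℝ} (hq : Tendsto q l (𝓝 0))
    (h : ∀ᶠ n in l, 0 < #{G : SimpleGraph (Fin n) | P n G} ∧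
      (#{G : SimpleGraph (Fin n) | P n G ∧ ¬ A n G} : ℝ) ≤
        q n * #{G : SimpleGraph (Fin n) | P n G}) :
    Tendsto (fun n => uniformOn {G : SimpleGraph (Fin n) | P n G} {G | A n G}) l (𝓝 1) := by
  have hlow : Tendsto (fun n => 1 - ENNReal.ofReal (q n)) l (𝓝 1) := by
    have h1 : Tendsto (fun n => ENNReal.ofReal (q n)) l (𝓝 0) := by
      simpa using ENNReal.tendsto_ofReal hq
    simpa using ENNReal.Tendsto.sub (tendsto_const_nhds (x := (1 : ENNReal))) h1 (by simp)
  refine tendsto_of_tendsto_of_tendsto_of_le_of_le' hlow tendsto_const_nhds ?_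
    (Eventually.of_forall fun n => MeasureTheory.prob_le_one)
  filter_upwards [h] with n hn
  obtain ⟨hpos, hle⟩ := hn
  have hne : {G : SimpleGraph (Fin n) | P n G}.Nonempty := by
    obtain ⟨G, hG⟩ := card_pos.1 hpos
    exact ⟨G, by simpa using hG⟩
  have hcompl := uniformOn_compl {G | A n G} (Set.toFinite {G : SimpleGraph (Fin n) | P n G}) hne
  rw [tsub_le_iff_right, ← hcompl]
  gcongr
  have h1 : {G : SimpleGraph (Fin n) | P n G} =
      ((univ.filter fun G : SimpleGraph (Fin n) => P n G : Finset _) : Set _) := by simp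
  have h2 : {G : SimpleGraph (Fin n) | A n G}ᶜ =
      ((univ.filter fun G : SimpleGraph (Fin n) => ¬ A n G : Finset _) : Set _) := by
    ext G
    simp
  rw [h1, h2, uniformOn_apply_finset, ← filter_and]
  have hpos' : (0 : ℝ) < #{G : SimpleGraph (Fin n) | P n G} := by exact_mod_cast hpos
  rw [← ENNReal.ofReal_natCast, ← ENNReal.ofReal_natCast, ← ENNReal.ofReal_div_of_pos hpos']
  exact ENNReal.ofReal_le_ofReal ((div_le_iff₀ hpos').2 hle)

end RealRegular

/-! ### Numerical estimates -/

section Estimates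

lemma pow_self_le_exp_mul_factorial (m : ℕ) : (m : ℝ) ^ m ≤ Real.exp 1 ^ m * m.factorial := by
  have h := Real.pow_div_factorial_le_exp (m : ℝ) m.cast_nonneg m
  rw [div_le_iff₀ (by exact_mod_cast m.factorial_pos)] at h
  rwa [← Real.exp_nat_mul, mul_one]

lemma exp_one_le_three : Real.exp 1 ≤ 3 := by
  have := Real.exp_one_lt_d9
  linarith

lemma choose_le_div_pow {n M : ℕ} (hM : 0 < M) :
    ((n + M).choose M : ℝ) ≤ (3 * ((n + M) / M)) ^ M := by
  have hM' : (0 : ℝ) < M := by exact_mod_cast hM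
  have h1 := Nat.choose_le_pow_div (α := ℝ) M (n + M)
  refine h1.trans ?_
  have hfac : (0 : ℝ) < M.factorial := by exact_mod_cast M.factorial_pos
  rw [div_le_iff₀ hfac]
  have h2 := pow_self_le_exp_mul_factorial M
  have h3 : Real.exp 1 ^ M ≤ 3 ^ M := by
    gcongr
    exact exp_one_le_three
  calc ((n + M : ℕ) : ℝ) ^ M = ((n + M) / M) ^ M * (M : ℝ) ^ M := by
        rw [← mul_pow, div_mul_cancel₀ _ hM'.ne']
        push_cast
        rfl
    _ ≤ ((n + M) / M) ^ M * (3 ^ M * M.factorial) := by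
        gcongr
        exact h2.trans (by gcongr)
    _ = _ := by
        rw [mul_pow]
        ring

/-- With `M` of order `n / (L log L)` the ratio `(n + M) / M` is below `L² / 3`, so the binomial is
at most `L^(2M) = 2^(2M log L) ≤ 2^(n/L)`. -/
lemma two_mul_choose_le_two_pow {n M X : ℕ} {L : ℝ} (hL : 0 < L) (hM : 0 < M)
    (hM₁ : (n : ℝ) ≤ 4 * L * Real.logb 2 L * M)
    (hM₂ : 2 * L * Real.logb 2 L * M ≤ n) (hd : 3 * (1 + 4 * L * Real.logb 2 L) ≤ L ^ 2)
    (hX : n / L + 1 ≤ X) : 2 * (n + M).choose M ≤ 2 ^ X := by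
  have hM' : (0 : ℝ) < M := by exact_mod_cast hM
  have h1 : 3 * (((n : ℝ) + M) / M) ≤ L ^ 2 := by
    refine le_trans ?_ hd
    gcongr
    rw [add_div, div_self hM'.ne', add_comm, add_le_add_iff_left, div_le_iff₀ hM']
    exact hM₁
  have hpow : L = 2 ^ Real.logb 2 L := (Real.rpow_logb two_pos (by norm_num) hL).symm
  have h2 : ((n + M).choose M : ℝ) ≤ 2 ^ (n / L : ℝ) := by
    calc ((n + M).choose M : ℝ) ≤ (3 * ((n + M) / M)) ^ M := choose_le_div_pow hM
      _ ≤ (L ^ 2) ^ M := by gcongr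
      _ = (2 : ℝ) ^ (Real.logb 2 L * (2 * M : ℕ)) := by
          rw [Real.rpow_mul two_pos.le, ← hpow, Real.rpow_natCast, pow_mul]
      _ ≤ 2 ^ (n / L : ℝ) := by
          refine Real.rpow_le_rpow_of_exponent_le one_le_two ?_
          rw [le_div_iff₀ hL]
          push_cast
          linarith
  have h3 : (2 * (n + M).choose M : ℝ) ≤ 2 ^ (X : ℝ) := by
    calc (2 * (n + M).choose M : ℝ) ≤ 2 * 2 ^ (n / L : ℝ) := by gcongr
      _ = 2 ^ (n / L + 1 : ℝ) := by
          rw [Real.rpow_add two_pos, Real.rpow_one, mul_comm]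
      _ ≤ 2 ^ (X : ℝ) := Real.rpow_le_rpow_of_exponent_le one_le_two hX
  rw [Real.rpow_natCast] at h3
  exact_mod_cast h3

/-- The quotient of the upper bound for the number of graphs that are not spread by the lower
bound for the number of regular graphs. -/
lemma le_half_pow_mul_of_factorial_bounds {n D E k M s X b t S T : ℕ} {ρ : ℝ} (hn : 0 < n)
    (hL : 512 * (108 * (D : ℝ) ^ 2) ≤ Real.logb 2 n) (hL1 : 1 ≤ Real.logb 2 n) (hρ : 2 < ρ)
    (hE : ρ * n / 2 ≤ E) (hS : S ≤ n ^ 2) (hT : T ≤ n ^ 2) (hM : M ≤ n)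
    (hX : (X : ℝ) ≤ 3 * (n / Real.logb 2 n)) (hs : (s : ℝ) ≤ 2 * (n : ℝ) ^ (1 / 2 - 1 / ρ))
    (hk : k.factorial ^ 2 ≤ 2 ^ n) (hk' : n ^ (6 * k) ≤ 2 ^ n)
    (hb : b * E.factorial ≤ M ^ n * T ^ X * (X * s ^ 2) ^ E)
    (ht : E.factorial ≤ t * (k.factorial ^ 2 * D ^ (2 * E) * S ^ (3 * k))) :
    (b : ℝ) ≤ (1 / 2) ^ n * t := by
  set L := Real.logb 2 n with hLdef
  have hn' : (0 : ℝ) < n := by exact_mod_cast hn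
  have hL0 : 0 < L := by linarith
  have hnE : (n : ℝ) ≤ E := by nlinarith
  have hnE' : n ≤ E := by exact_mod_cast hnE
  have hE0 : (0 : ℝ) < E := hn'.trans_le hnE
  have hnL : (n : ℝ) = 2 ^ L := (Real.rpow_logb two_pos (by norm_num) hn').symm
  have hcount : (b : ℝ) * (E.factorial : ℝ) ^ 2 ≤
      ((n : ℝ) ^ n * ((n : ℝ) ^ 2) ^ X * (X * s ^ 2) ^ E) *
        (t * (2 ^ n * D ^ (2 * E) * 2 ^ n)) := by
    have h1 : b * E.factorial ^ 2 ≤ (n ^ n * (n ^ 2) ^ X * (X * s ^ 2) ^ E) *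
        (t * (2 ^ n * D ^ (2 * E) * 2 ^ n)) := by
      calc b * E.factorial ^ 2 = b * E.factorial * E.factorial := by ring
        _ ≤ (M ^ n * T ^ X * (X * s ^ 2) ^ E) *
            (t * (k.factorial ^ 2 * D ^ (2 * E) * S ^ (3 * k))) := Nat.mul_le_mul hb ht
        _ ≤ (n ^ n * (n ^ 2) ^ X * (X * s ^ 2) ^ E) *
            (t * (2 ^ n * D ^ (2 * E) * (n ^ 2) ^ (3 * k))) := by gcongr
        _ ≤ _ := by
            have h6 : (n ^ 2) ^ (3 * k) = n ^ (6 * k) := by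
              rw [← pow_mul]
              congr 1
              ring
            rw [h6]
            exact Nat.mul_le_mul_left _ (Nat.mul_le_mul_left _ (Nat.mul_le_mul_left _ hk'))
    exact_mod_cast h1
  -- `n^(2X) = 2^(2LX)` and `LX ≤ 3n`.
  have hXpow : ((n : ℝ) ^ 2) ^ X ≤ 64 ^ n := by
    rw [← pow_mul, ← Real.rpow_natCast]
    nth_rewrite 1 [hnL]
    rw [← Real.rpow_mul two_pos.le, show (64 : ℝ) = 2 ^ (6 : ℝ) by norm_num, ← Real.rpow_natCast,
      ← Real.rpow_mul two_pos.le]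
    refine Real.rpow_le_rpow_of_exponent_le one_le_two ?_
    have h : L * X ≤ L * (3 * (n / L)) := by gcongr
    have h' : L * (3 * (n / L)) = 3 * n := by field_simp
    push_cast
    linarith
  have hsq : (s : ℝ) ^ 2 ≤ 4 * (n * (n : ℝ) ^ (-(2 / ρ))) := by
    have h : ((n : ℝ) ^ (1 / 2 - 1 / ρ)) ^ 2 = n * (n : ℝ) ^ (-(2 / ρ)) := by
      rw [← Real.rpow_natCast, ← Real.rpow_mul hn'.le]
      nth_rewrite 2 [← Real.rpow_one (n : ℝ)]
      rw [← Real.rpow_add hn']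
      congr 1
      push_cast
      ring
    rw [← h]
    calc (s : ℝ) ^ 2 ≤ (2 * (n : ℝ) ^ (1 / 2 - 1 / ρ)) ^ 2 := by gcongr
      _ = _ := by ring
  -- `108 = 9 * 3 * 4`: from `e² ≤ 9`, `X ≤ 3n/L` and `s² ≤ 4 n^(1 - 2/ρ)`.
  set c : ℝ := 108 * (D : ℝ) ^ 2 with hc
  have hc0 : 0 ≤ c := by positivity
  have hcL : c / L ≤ 1 / 512 := by
    rw [div_le_div_iff₀ hL0 (by norm_num)]
    linarith
  have hbase : Real.exp 1 ^ 2 * (D : ℝ) ^ 2 * (X * s ^ 2) ≤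
      (E : ℝ) ^ 2 * (c / L) * (n : ℝ) ^ (-(2 / ρ)) := by
    calc Real.exp 1 ^ 2 * (D : ℝ) ^ 2 * (X * s ^ 2)
        ≤ 3 ^ 2 * (D : ℝ) ^ 2 * (3 * (n / L) * (4 * (n * (n : ℝ) ^ (-(2 / ρ))))) := by
          gcongr
          exact exp_one_le_three
      _ = (n : ℝ) ^ 2 * (c / L) * (n : ℝ) ^ (-(2 / ρ)) := by
          rw [hc]
          ring
      _ ≤ _ := by gcongr
  -- The decisive cancellation, and the source of the exponent `1/2 - 1/ρ`: `2E/ρ ≥ n`.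
  have hnpow : ((n : ℝ) ^ (-(2 / ρ))) ^ E * (n : ℝ) ^ n ≤ 1 := by
    rw [← Real.rpow_natCast, ← Real.rpow_mul hn'.le, ← Real.rpow_natCast, ← Real.rpow_add hn']
    refine Real.rpow_le_one_of_one_le_of_nonpos (by exact_mod_cast hn) ?_
    have : (n : ℝ) ≤ 2 / ρ * E := by
      calc (n : ℝ) = 2 / ρ * (ρ * n / 2) := by field_simp
        _ ≤ _ := by gcongr
    linarith
  -- The other exponential factors amount to `(64 * 2 * 2)^n = 256^n`, so `512` leaves `(1/2)^n`.
  have hcpow : (c / L) ^ E ≤ (1 / 512) ^ n := by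
    calc (c / L) ^ E ≤ (1 / 512) ^ E := by gcongr
      _ ≤ (1 / 512) ^ n := pow_le_pow_of_le_one (by norm_num) (by norm_num) hnE'
  have hfac := pow_self_le_exp_mul_factorial E
  have hEE : (0 : ℝ) < (E : ℝ) ^ (2 * E) := by positivity
  refine le_of_mul_le_mul_right ?_ hEE
  calc (b : ℝ) * (E : ℝ) ^ (2 * E) = b * ((E : ℝ) ^ E) ^ 2 := by
        rw [← pow_mul, mul_comm E 2]
    _ ≤ b * (Real.exp 1 ^ E * E.factorial) ^ 2 := by gcongr
    _ = Real.exp 1 ^ (2 * E) * (b * (E.factorial : ℝ) ^ 2) := by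
        rw [mul_pow, ← pow_mul, mul_comm E 2]
        ring
    _ ≤ Real.exp 1 ^ (2 * E) * (((n : ℝ) ^ n * 64 ^ n * (X * s ^ 2) ^ E) *
        (t * (2 ^ n * D ^ (2 * E) * 2 ^ n))) := by
        refine mul_le_mul_of_nonneg_left (hcount.trans ?_) (by positivity)
        gcongr
    _ = (Real.exp 1 ^ 2 * (D : ℝ) ^ 2 * (X * s ^ 2)) ^ E * (n : ℝ) ^ n *
        (64 ^ n * 2 ^ n * 2 ^ n) * t := by
        rw [mul_pow (Real.exp 1 ^ 2 * (D : ℝ) ^ 2), mul_pow (Real.exp 1 ^ 2), ← pow_mul, ← pow_mul]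
        ring
    _ ≤ ((E : ℝ) ^ 2 * (c / L) * (n : ℝ) ^ (-(2 / ρ))) ^ E * (n : ℝ) ^ n *
        (64 ^ n * 2 ^ n * 2 ^ n) * t := by gcongr
    _ = (((n : ℝ) ^ (-(2 / ρ))) ^ E * (n : ℝ) ^ n) * (c / L) ^ E *
        ((E : ℝ) ^ (2 * E) * (64 ^ n * 2 ^ n * 2 ^ n) * t) := by
        rw [mul_pow, mul_pow, ← pow_mul]
        ring
    _ ≤ 1 * (1 / 512) ^ n * ((E : ℝ) ^ (2 * E) * (64 ^ n * 2 ^ n * 2 ^ n) * t) := by gcongr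
    _ = (1 / 512 * (64 * 2 * 2)) ^ n * t * (E : ℝ) ^ (2 * E) := by
        rw [mul_pow, mul_pow, mul_pow]
        ring
    _ = _ := by norm_num

lemma tendsto_logb_two_natCast : Tendsto (fun n : ℕ => Real.logb 2 n) atTop atTop :=
  (Real.tendsto_logb_atTop one_lt_two).comp tendsto_natCast_atTop_atTop

lemma eventually_mul_logb_two_le (C : ℝ) : ∀ᶠ x : ℝ in atTop, C * Real.logb 2 x ≤ x := by
  have h := (Real.isLittleO_log_id_atTop.const_mul_left (C / Real.log 2)).bound one_pos
  filter_upwards [h, eventually_ge_atTop 0] with x hx hx0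
  rw [one_mul, id, Real.norm_of_nonneg hx0] at hx
  calc C * Real.logb 2 x = C / Real.log 2 * Real.log x := by
        rw [Real.logb]
        ring
    _ ≤ x := (le_abs_self _).trans hx

lemma eventually_logb_two_sq_le : ∀ᶠ n : ℕ in atTop, Real.logb 2 n ^ 2 ≤ n := by
  have h := ((Real.isLittleO_pow_log_id_atTop (n := 2)).const_mul_left ((1 / Real.log 2) ^ 2)).bound
    one_pos
  filter_upwards [tendsto_natCast_atTop_atTop.eventually h] with n hn
  rw [one_mul, id, Real.norm_of_nonneg n.cast_nonneg] at hn
  calc Real.logb 2 n ^ 2 = (1 / Real.log 2) ^ 2 * Real.log n ^ 2 := by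
        rw [Real.logb]
        ring
    _ ≤ (n : ℝ) := (le_abs_self _).trans hn

lemma eventually_pow_le_two_pow (k : ℕ) : ∀ᶠ n : ℕ in atTop, n ^ k ≤ 2 ^ n := by
  have h := (isLittleO_pow_const_const_pow_of_one_lt (R := ℝ) k one_lt_two).bound one_pos
  filter_upwards [h] with n hn
  rw [one_mul, Real.norm_of_nonneg (by positivity), Real.norm_of_nonneg (by positivity)] at hn
  exact_mod_cast hn

lemma eventually_le_two_pow (k : ℕ) : ∀ᶠ n : ℕ in atTop, k ≤ 2 ^ n :=
  (tendsto_pow_atTop_atTop_of_one_lt one_lt_two).eventually_ge_atTop k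

lemma card_sym2_fin_le_sq {m n : ℕ} (hm : m ≤ n) : Fintype.card (Sym2 (Fin m)) ≤ n ^ 2 := by
  refine le_trans ?_ (Nat.pow_le_pow_left hm 2)
  have h := Fintype.card_le_of_surjective (fun p : Fin m × Fin m => s(p.1, p.2))
    (by rintro ⟨a, b⟩; exact ⟨(a, b), rfl⟩)
  simpa [sq] using h

end Estimates

/-! ### Choice of parameters and the two ranges of `ρ` -/

section Main

open Finset

/-- The lower bound for the minimum ordered Ramsey number, uniformly for bounded degrees
`ρ n > 2`. -/
theorem realRegularAAS_le_minOrderedRamsey {ρ : ℕ → ℝ} {D : ℕ}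
    (hρ : ∀ᶠ n in atTop, 2 < ρ n ∧ ρ n + 1 ≤ D) :
    RealRegularAAS ρ fun n G =>
      (n : ℝ) ^ (3 / 2 - 1 / ρ n) / (4 * Real.logb 2 n * Real.logb 2 (Real.logb 2 n))
        ≤ (minOrderedRamsey G : ℝ) := by
  classical
  have hq : Tendsto (fun n : ℕ => (1 / 2 : ℝ) ^ n) (atTop ⊓ 𝓟 {n : ℕ | Even ⌈ρ n * n⌉}) (𝓝 0) :=
    (tendsto_pow_atTop_nhds_zero_of_lt_one (by norm_num) (by norm_num)).mono_left inf_le_left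
  refine tendsto_uniformOn_of_card_le hq (P := fun n G => IsRealRegular (ρ n) G) ?_
  rw [eventually_inf_principal]
  set k := D * (2 * D + 1) with hk
  filter_upwards [hρ, eventually_gt_atTop ((2 * D + 2) * D + k),
    tendsto_logb_two_natCast.eventually_ge_atTop (512 * (108 * (D : ℝ) ^ 2)),
    tendsto_logb_two_natCast.eventually_ge_atTop 4,
    tendsto_logb_two_natCast.eventually (eventually_mul_logb_two_le 24),
    eventually_logb_two_sq_le, eventually_pow_le_two_pow (6 * k),
    eventually_le_two_pow (k.factorial ^ 2)] with n ⟨hρ2, hρD⟩ hnlarge hLD hL4 hLL hLn hnk hkf heven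
  obtain ⟨E', hE'⟩ := heven
  set L := Real.logb 2 n with hL
  have hn : 0 < n := by omega
  have hn' : (0 : ℝ) < n := by exact_mod_cast hn
  have hρpos : 0 < ρ n := by linarith
  have hE'pos : 0 ≤ E' := by
    have : 0 ≤ ⌈ρ n * n⌉ := Int.ceil_nonneg (by positivity)
    omega
  obtain ⟨E, rfl⟩ := Int.eq_ofNat_of_zero_le hE'pos
  have hE : 2 * (E : ℤ) = ⌈ρ n * n⌉ := by rw [hE', two_mul]
  have hEρ : ρ n * n / 2 ≤ E := by
    have h1 : ρ n * n ≤ (⌈ρ n * n⌉ : ℝ) := Int.le_ceil _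
    rw [← hE] at h1
    push_cast at h1
    linarith
  have hnE : n ≤ E := by
    have : (n : ℝ) ≤ E := by nlinarith
    exact_mod_cast this
  have hL0 : 0 < L := by linarith
  have hLL2 : 2 ≤ Real.logb 2 L := by
    rw [Real.le_logb_iff_rpow_le one_lt_two hL0]
    norm_num
    exact hL4
  set K := Real.logb 2 L with hK
  have hK0 : 0 < K := by linarith
  have hLK : 24 * (L * K) ≤ L ^ 2 := by nlinarith
  have hden : 0 < 4 * L * K := by positivity
  -- `M` and `s` are rounded up so that `M * s` reaches the claimed bound. Rounding costs at most a
  -- factor 2 in `M` and `s`, which the slack in `hM₂` and `hsup` absorbs.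
  set M := ⌊(n : ℝ) / (4 * L * K)⌋₊ + 1 with hM
  set s := ⌈(n : ℝ) ^ (1 / 2 - 1 / ρ n)⌉₊ with hs
  set X := ⌈2 * ((n : ℝ) / L)⌉₊ with hX
  have hMlow : (n : ℝ) / (4 * L * K) ≤ M := by
    rw [hM]
    push_cast
    exact (Nat.lt_floor_add_one _).le
  have hMup : (M : ℝ) ≤ n / (4 * L * K) + 1 := by
    rw [hM]
    push_cast
    gcongr
    exact Nat.floor_le (by positivity)
  have hM₁ : (n : ℝ) ≤ 4 * L * K * M := by
    rwa [div_le_iff₀ hden, mul_comm] at hMlow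
  have hM₂ : 2 * L * K * M ≤ n := by
    have h1 : 4 * L * K * M ≤ n + 4 * L * K := by
      calc 4 * L * K * M ≤ 4 * L * K * (n / (4 * L * K) + 1) := by gcongr
        _ = _ := by field_simp
    nlinarith
  have hMn : M ≤ n := by
    have h1 : (M : ℝ) ≤ 2 * L * K * M := by
      have h2 : 1 ≤ 2 * L * K := by nlinarith
      exact le_mul_of_one_le_left M.cast_nonneg h2
    exact_mod_cast h1.trans hM₂
  have hnL1 : 1 ≤ (n : ℝ) / L := by
    rw [le_div_iff₀ hL0]
    nlinarith
  have hXlow : (n : ℝ) / L + 1 ≤ X := by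
    have := Nat.le_ceil (2 * ((n : ℝ) / L))
    linarith
  have hXup : (X : ℝ) ≤ 3 * (n / L) := by
    have := (Nat.ceil_lt_add_one (a := 2 * ((n : ℝ) / L)) (by positivity)).le
    linarith
  have hs1 : 1 ≤ (n : ℝ) ^ (1 / 2 - 1 / ρ n) := by
    refine Real.one_le_rpow (by exact_mod_cast hn) ?_
    rw [sub_nonneg]
    exact one_div_le_one_div_of_le two_pos hρ2.le
  have hsup : (s : ℝ) ≤ 2 * (n : ℝ) ^ (1 / 2 - 1 / ρ n) := by
    have := (Nat.ceil_lt_add_one (a := (n : ℝ) ^ (1 / 2 - 1 / ρ n)) (by positivity)).le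
    linarith
  have hchoose : 2 * (Fintype.card (Fin n) + M).choose M ≤ 2 ^ X := by
    rw [Fintype.card_fin]
    exact two_mul_choose_le_two_pow hL0 (Nat.succ_pos _) hM₁ hM₂ (by nlinarith) hXlow
  have hthr : (n : ℝ) ^ (3 / 2 - 1 / ρ n) / (4 * L * K) ≤ M * s := by
    calc (n : ℝ) ^ (3 / 2 - 1 / ρ n) / (4 * L * K)
        = n / (4 * L * K) * (n : ℝ) ^ (1 / 2 - 1 / ρ n) := by
          rw [show 3 / 2 - 1 / ρ n = 1 + (1 / 2 - 1 / ρ n) by ring, Real.rpow_add hn',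
            Real.rpow_one]
          ring
      _ ≤ M * s := by
          gcongr
          exact Nat.le_ceil _
  have hlower := factorial_le_card_isRealRegular hρpos hρD hE (by omega)
  refine ⟨?_, ?_⟩
  -- The lower count also gives existence: without regular graphs it would read `E! ≤ 0`.
  · by_contra h0
    rw [Nat.eq_zero_of_not_pos h0, zero_mul] at hlower
    exact absurd E.factorial_pos (by omega)
  · have hbad : #{G : SimpleGraph (Fin n) | IsRealRegular (ρ n) G ∧
        ¬ (n : ℝ) ^ (3 / 2 - 1 / ρ n) / (4 * L * K) ≤ (minOrderedRamsey G : ℝ)} ≤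
        #{H : Finset (Sym2 (Fin n)) | #H = E ∧ ¬ IsSpread H M s X} := by
      refine le_trans (card_le_card fun G hG => ?_) (card_isRealRegular_not_isSpread_le hE)
      simp only [mem_filter, mem_univ, true_and] at hG ⊢
      refine ⟨hG.1, fun hspread => hG.2 (hthr.trans ?_)⟩
      have : Nonempty (LinearOrder (Fin n)) := ⟨inferInstance⟩
      exact_mod_cast (lt_minOrderedRamsey_of_isSpread hspread hchoose).le
    have hupper := card_not_isSpread_mul_factorial_le (V := Fin n) (M := M) (s := s) (X := X)
      (hn.trans_le hnE)
    rw [Fintype.card_fin] at hupper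
    exact le_half_pow_mul_of_factorial_bounds hn hLD (by linarith) hρ2 hEρ
      (card_sym2_fin_le_sq le_rfl) (card_sym2_fin_le_sq hMn) hMn hXup hsup hkf hnk
      ((Nat.mul_le_mul_right _ hbad).trans hupper) hlower

lemma isRealRegular_natCast_iff {n d : ℕ} {G : SimpleGraph (Fin n)}
    [∀ v, Fintype (G.neighborSet v)] : IsRealRegular d G ↔ G.IsRegularOfDegree d := by
  classical
  rw [isRealRegular_iff]
  have hce : ⌈(d : ℝ) * n⌉ = ((d * n : ℕ) : ℤ) := by
    exact_mod_cast Int.ceil_natCast (R := ℝ) (d * n)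
  rw [Int.floor_natCast, Int.ceil_natCast, hce]
  simp only [or_self, Nat.cast_inj]
  refine ⟨fun h v => (edgeDegree_edgeFinset G v).symm.trans (h.1 v), fun h => ?_⟩
  have hdeg : ∀ v, edgeDegree G.edgeFinset v = d := fun v =>
    (edgeDegree_edgeFinset G v).trans (h v)
  refine ⟨hdeg, ?_⟩
  have hsum := sum_edgeDegree (H := G.edgeFinset) fun e he =>
    G.not_isDiag_of_mem_edgeFinset he
  rw [sum_congr rfl fun v _ => hdeg v, sum_const, card_univ, Fintype.card_fin, smul_eq_mul,
    mul_comm] at hsum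
  exact_mod_cast hsum.symm

lemma RealRegularAAS.mono {ρ : ℕ → ℝ} {A B : (n : ℕ) → SimpleGraph (Fin n) → Prop}
    (hA : RealRegularAAS ρ A) (h : ∀ᶠ n in atTop, ∀ G, A n G → B n G) : RealRegularAAS ρ B := by
  refine tendsto_of_tendsto_of_tendsto_of_le_of_le' hA tendsto_const_nhds ?_
    (Eventually.of_forall fun n => MeasureTheory.prob_le_one)
  exact (h.filter_mono inf_le_left).mono fun n hn => MeasureTheory.measure_mono fun G hG => hn G hG

lemma RealRegularAAS.almostEveryRegular {d : ℕ} {A : (n : ℕ) → SimpleGraph (Fin n) → Prop}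
    (h : RealRegularAAS (fun _ => (d : ℝ)) A) : AlmostEveryRegular d A := by
  unfold RealRegularAAS at h
  unfold AlmostEveryRegular
  have hce : ∀ n : ℕ, Even ⌈(d : ℝ) * n⌉ ↔ Even (d * n) := fun n => by
    have : ⌈(d : ℝ) * n⌉ = ((d * n : ℕ) : ℤ) := by
      exact_mod_cast Int.ceil_natCast (R := ℝ) (d * n)
    rw [this, Int.even_coe_nat]
  simp only [hce] at h
  classical
  have hset : ∀ n, {G : SimpleGraph (Fin n) | IsRealRegular (d : ℝ) G} =
      {G | G.IsRegularOfDegree d} := fun n => Set.ext fun G => isRealRegular_natCast_iff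
  simp only [hset] at h
  convert h

/-- Bounding `log log n` by `log n`, it suffices that `n^(1/6)` outgrows every multiple of `(log
n)²`. -/
lemma eventually_mul_le_rpow_div (C : ℝ) : ∀ᶠ n : ℕ in atTop, C * n ≤
    (n : ℝ) ^ (7 / 6 : ℝ) / (4 * Real.logb 2 n * Real.logb 2 (Real.logb 2 n)) := by
  have hlog := ((isLittleO_log_rpow_rpow_atTop 2 (show (0 : ℝ) < 1 / 6 by norm_num)).const_mul_left
    (4 * |C| * (1 / Real.log 2) ^ 2)).bound one_pos
  filter_upwards [tendsto_natCast_atTop_atTop.eventually hlog, eventually_gt_atTop 0,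
    tendsto_logb_two_natCast.eventually_ge_atTop 2,
    tendsto_logb_two_natCast.eventually (eventually_mul_logb_two_le 1)] with n hn hn0 hL hLL
  have hn' : (0 : ℝ) < n := by exact_mod_cast hn0
  set L := Real.logb 2 n with hLdef
  have hK : 0 < Real.logb 2 L := Real.logb_pos one_lt_two (by linarith)
  have hL0 : 0 < L := by linarith
  rw [one_mul, Real.norm_of_nonneg (by positivity : (0 : ℝ) ≤ (n : ℝ) ^ (1 / 6 : ℝ)),
    Real.rpow_two] at hn
  have hL2 : 4 * |C| * L ^ 2 ≤ (n : ℝ) ^ (1 / 6 : ℝ) := by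
    refine le_trans (le_of_eq ?_) ((le_abs_self _).trans hn)
    rw [hLdef, Real.logb]
    ring
  rw [le_div_iff₀ (by positivity), show (7 / 6 : ℝ) = 1 + 1 / 6 by norm_num, Real.rpow_add hn',
    Real.rpow_one]
  calc C * n * (4 * L * Real.logb 2 L) ≤ |C| * n * (4 * L * L) := by
        gcongr
        · exact le_abs_self C
        · linarith
    _ = n * (4 * |C| * L ^ 2) := by ring
    _ ≤ _ := by gcongr

/-- The excess `9K/L` of `ρ` over 2 gives `n^(1/2 - 1/ρ) = 2^(9K/(2ρ))`. Once `ρ ≤ 36/17` this is at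
least `L^(17/8)`, and `L ≥ 256` makes the spare `L^(1/8)` at least 2. -/
lemma eventually_mul_logb_div_le :
    ∀ᶠ n : ℕ in atTop, n * Real.logb 2 n / (2 * Real.logb 2 (Real.logb 2 n)) ≤
      (n : ℝ) ^ (3 / 2 - 1 / (2 + 9 * Real.logb 2 (Real.logb 2 n) / Real.logb 2 n)) /
        (4 * Real.logb 2 n * Real.logb 2 (Real.logb 2 n)) := by
  filter_upwards [eventually_gt_atTop 0, tendsto_logb_two_natCast.eventually_ge_atTop 256,
    tendsto_logb_two_natCast.eventually (eventually_mul_logb_two_le (153 / 2))] with n hn0 hL hLL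
  have hn' : (0 : ℝ) < n := by exact_mod_cast hn0
  set L := Real.logb 2 n with hLdef
  have hL0 : 0 < L := by linarith
  have hK : 0 < Real.logb 2 L := Real.logb_pos one_lt_two (by linarith)
  set K := Real.logb 2 L with hKdef
  set ρ := 2 + 9 * K / L with hρ
  have hρ2 : 2 < ρ := by
    rw [hρ]
    have : 0 < 9 * K / L := by positivity
    linarith
  have hρup : ρ ≤ 36 / 17 := by
    have : 9 * K / L ≤ 2 / 17 := by
      rw [div_le_iff₀ hL0]
      linarith
    linarith
  have hexp : K * (17 / 8) ≤ L * (1 / 2 - 1 / ρ) := by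
    have h1 : L * (1 / 2 - 1 / ρ) = K * (9 / (2 * ρ)) := by
      have h2 : L * (ρ - 2) = 9 * K := by
        rw [hρ]
        field_simp
        ring
      have hρ0 : ρ ≠ 0 := by linarith
      calc L * (1 / 2 - 1 / ρ) = L * (ρ - 2) / (2 * ρ) := by field_simp
        _ = _ := by rw [h2]; ring
    rw [h1]
    refine mul_le_mul_of_nonneg_left ?_ hK.le
    rw [le_div_iff₀ (by linarith)]
    linarith
  have hpow : 2 * L ^ 2 ≤ (n : ℝ) ^ (1 / 2 - 1 / ρ) := by
    calc 2 * L ^ 2 ≤ L ^ (1 / 8 : ℝ) * L ^ 2 := by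
          gcongr
          calc (2 : ℝ) = 256 ^ (1 / 8 : ℝ) := by
                rw [show (256 : ℝ) = 2 ^ (8 : ℝ) by norm_num, ← Real.rpow_mul two_pos.le]
                norm_num
            _ ≤ L ^ (1 / 8 : ℝ) := by gcongr
      _ = L ^ (17 / 8 : ℝ) := by
          rw [← Real.rpow_two, ← Real.rpow_add hL0]
          norm_num
      _ = 2 ^ (K * (17 / 8)) := by
          rw [Real.rpow_mul two_pos.le, hKdef, Real.rpow_logb two_pos (by norm_num) hL0]
      _ ≤ 2 ^ (L * (1 / 2 - 1 / ρ)) := Real.rpow_le_rpow_of_exponent_le one_le_two hexp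
      _ = _ := by
          rw [Real.rpow_mul two_pos.le, hLdef, Real.rpow_logb two_pos (by norm_num) hn']
  rw [div_le_div_iff₀ (by positivity) (by positivity),
    show 3 / 2 - 1 / ρ = 1 + (1 / 2 - 1 / ρ) by ring, Real.rpow_add hn', Real.rpow_one]
  calc n * L * (4 * L * K) = n * (2 * L ^ 2) * (2 * K) := by ring
    _ ≤ _ := by gcongr

end Main

theorem mainTheorem1 :
    (∀ ρ : ℝ, 2 < ρ →
      RealRegularAAS (fun _ => ρ) fun n G =>
        (n : ℝ) ^ (3 / 2 - 1 / ρ) / (4 * Real.logb 2 n * Real.logb 2 (Real.logb 2 n))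
          ≤ (minOrderedRamsey G : ℝ)) ∧
    (AlmostEveryRegular 3 fun n G =>
      (n : ℝ) ^ (7 / 6 : ℝ) / (4 * Real.logb 2 n * Real.logb 2 (Real.logb 2 n))
        ≤ (minOrderedRamsey G : ℝ)) ∧
    (∀ C : ℝ, AlmostEveryRegular 3 fun n G =>
      ∀ o : LinearOrder (Fin n), C * n ≤ (OrderedGraph.ramsey ⟨G, o⟩ : ℝ)) ∧
    (RealRegularAAS (fun n => 2 + 9 * Real.logb 2 (Real.logb 2 n) / Real.logb 2 n) fun n G =>
      n * Real.logb 2 n / (2 * Real.logb 2 (Real.logb 2 n)) ≤ (minOrderedRamsey G : ℝ)) := by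

  have h1 : ∀ ρ : ℝ, 2 < ρ →
      RealRegularAAS (fun _ => ρ) fun n G =>
        (n : ℝ) ^ (3 / 2 - 1 / ρ) / (4 * Real.logb 2 n * Real.logb 2 (Real.logb 2 n))
          ≤ (minOrderedRamsey G : ℝ) := fun ρ hρ =>
    realRegularAAS_le_minOrderedRamsey (D := ⌈ρ + 1⌉₊)
      (Eventually.of_forall fun _ => ⟨hρ, Nat.le_ceil _⟩)
  have h3 : RealRegularAAS (fun _ => ((3 : ℕ) : ℝ)) fun n G =>
      (n : ℝ) ^ (7 / 6 : ℝ) / (4 * Real.logb 2 n * Real.logb 2 (Real.logb 2 n))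
        ≤ (minOrderedRamsey G : ℝ) := by
    have := h1 ((3 : ℕ) : ℝ) (by norm_num)
    rwa [show (3 / 2 - 1 / ((3 : ℕ) : ℝ) : ℝ) = 7 / 6 by norm_num] at this
  refine ⟨h1, h3.almostEveryRegular, fun C => ?_, ?_⟩
  · refine RealRegularAAS.almostEveryRegular (h3.mono ?_)
    filter_upwards [eventually_mul_le_rpow_div C] with n hn G hG o
    exact (hn.trans hG).trans (by exact_mod_cast minOrderedRamsey_le_ramsey G o)
  -- `D = 4` suffices because eventually `9K/L ≤ 1`, hence `ρ + 1 ≤ 4`.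
  · have h4 := realRegularAAS_le_minOrderedRamsey (D := 4)
      (ρ := fun n => 2 + 9 * Real.logb 2 (Real.logb 2 n) / Real.logb 2 n) ?_
    · exact h4.mono (eventually_mul_logb_div_le.mono fun n hn G hG => hn.trans hG)
    filter_upwards [tendsto_logb_two_natCast.eventually_ge_atTop 2,
      tendsto_logb_two_natCast.eventually (eventually_mul_logb_two_le 9)] with n hL hLL
    have hL0 : 0 < Real.logb 2 n := by linarith
    have hK : 0 < Real.logb 2 (Real.logb 2 n) := Real.logb_pos one_lt_two (by linarith)
    constructor
    · have : 0 < 9 * Real.logb 2 (Real.logb 2 n) / Real.logb 2 n := by positivity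
      linarith
    · have : 9 * Real.logb 2 (Real.logb 2 n) / Real.logb 2 n ≤ 1 := by rwa [div_le_one hL0]
      push_cast
      linarith
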